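/- Let $n\ge 1$, let $D$ be a non-singular real $n\times n$ matrix, let $h_1,\dots,h_n>0$ and $\sigma>0$. For $\eta>0$ and $\mu\in\mathbb R$ put $\tilde\sigma=\sigma/\sqrt{1+\eta\mu^2}$ and let $\Lambda=(\Lambda_1,\dots,\Lambda_n)$ have independent components with $$\Lambda_i\mid V_i\sim \mathrm N\big(\tilde\sigma\mu(V_i-h_i),\,\tilde\sigma^2V_i\big),$$ where either $V_i\sim \mathrm{IG}(h_i,h_i^2/\eta)$ (inverse Gaussian with mean $h_i$ and shape $h_i^2/\eta$; NIG noise) for all $i$, or $V_i\sim\mathrm{Gamma}(h_i/\eta,1/\eta)$ (shape, rate; GAL noise) for all $i$. Let $x$ be the random vector with $Dx=\Lambda$ and let $x^B$ be the base Gaussian model $Dx^B=Z$, where $Z_i\sim \mathrm N(0,\sigma^2h_i)$ are independent. The tail-corrected parameters $(\eta^\star,\mu^\star)$ are related to $(\eta,\mu)$ by $\mu=\mu^\star/\sqrt\eta$ and $$\eta=\eta^\star\big(1+\mu^{\star2}-|\mu^\star|\sqrt{1+\mu^{\star2}}\big)^2\ \text{(NIG)},\qquad \eta=\tfrac12\eta^\star(1+\mu^{\star2})\big(\sqrt{2+\mu^{\star2}}-|\mu^\star|\big)^2\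 \text{(GAL)}.$$ Let $K(\eta)=\mathrm{KLD}(x\,\|\,x^B)$ at $\mu=0$, a function of $\eta>0$, and put $c=\frac3{16}\sum_{i=1}^n h_i^{-2}>0$. The following holds for NIG and for GAL noise. 1. For small $\eta>0$, $K(\eta)$ is finite, and $K(\eta)=c\,\eta^2+O(\eta^3)$ as $\eta\downarrow0$. Hence $\sqrt{2K(\eta)}\sim\sqrt{2c}\,\eta$ as $\eta\downarrow 0$, and $c\,\eta^2$ is the unique second-order expansion of $K$ at $0^+$, that is, the unique polynomial $q$ of degree at most $2$ with $K(\eta)-q(\eta)=o(\eta^2)$. 2. With the second-order expansion $q$ as the measure of complexity, the distance is proportional to $\eta$: $d(\eta)=\sqrt{2q(\eta)}=\sqrt{2c}\,\eta$ for $\eta\ge0$. 3. For each $\theta>0$ put $\theta_\eta=\theta\sqrt{2c}>0$. The PC prior for $\eta$ with rate $\theta$, that is, the law of $\eta\ge 0$ under which $d(\eta)$ is exponential with rate $\theta$, exists, is unique, and is the exponential distribution with rate $\theta_\eta$. Its density is $\pi(\eta)=\theta|d'(\eta)|e^{-\theta d(\eta)}=\theta_\eta e^{-\theta_\eta\eta}$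 for $\eta\ge0$ (with the right derivative at $0$), so that $\log\pi(\eta)=-\theta_\eta\eta+\text{const}$, an $L^1$ (LASSO) penalty on $\eta$. The same statements, with the same constants, hold for $\eta^\star$ in place of $\eta$ (with $\mu^\star=0$ in place of $\mu=0$). -/

import Mathlib

open MeasureTheory ProbabilityTheory

/-- The two families of driving noise: normal inverse Gaussian (NIG) and generalized asymmetric
Laplace (GAL). -/
inductive NoiseKind where
  | nig
  | gal

/-- Density of the inverse Gaussian distribution `IG(m, l)` with mean `m` and shape `l`
(its variance is `m ^ 3 / l`). -/
noncomputable def invGaussianPDFReal (m l v : ℝ) : ℝ :=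
  if 0 < v then
    Real.sqrt (l / (2 * Real.pi * v ^ 3)) * Real.exp (-(l * (v - m) ^ 2) / (2 * m ^ 2 * v))
  else 0

/-- The inverse Gaussian distribution with mean `m` and shape `l`. -/
noncomputable def invGaussianMeasure (m l : ℝ) : Measure ℝ :=
  volume.withDensity fun v => ENNReal.ofReal (invGaussianPDFReal m l v)

/-- Law of the mixing variable `V`: `IG(h, h ^ 2 / η)` for NIG noise and `Gamma` with shape `h / η`
and rate `1 / η` for GAL noise. In both cases the mean is `h` and the variance is `h * η`. -/
noncomputable def mixingLaw (kind : NoiseKind) (h η : ℝ) : Measure ℝ :=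
  match kind with
  | .nig => invGaussianMeasure h (h ^ 2 / η)
  | .gal => gammaMeasure (h / η) (1 / η)

/-- Law of one noise variable `Λ`, given hierarchically by
`Λ | V ~ N(σ' * μ * (V - h), σ' ^ 2 * V)`, where `σ' = σ / √(1 + η * μ ^ 2)`. -/
noncomputable def noiseLaw (kind : NoiseKind) (h σ η μ : ℝ) : Measure ℝ :=
  (mixingLaw kind h η).bind fun v =>
    gaussianReal (σ / Real.sqrt (1 + η * μ ^ 2) * μ * (v - h))
      ((σ / Real.sqrt (1 + η * μ ^ 2)) ^ 2 * v).toNNReal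

/-- Law of the flexible model: the random vector `x` with `D x = Λ`, where `Λ` has independent
components and `Λ i` has law `noiseLaw kind (h i) σ η μ`. -/
noncomputable def flexibleLaw (kind : NoiseKind) {n : ℕ} (D : Matrix (Fin n) (Fin n) ℝ)
    (h : Fin n → ℝ) (σ η μ : ℝ) : Measure (Fin n → ℝ) :=
  (Measure.pi fun i => noiseLaw kind (h i) σ η μ).map fun l => D⁻¹.mulVec l

/-- Law of the base Gaussian model: the random vector `x` with `D x = Z`, where `Z` has independent
components and `Z i ~ N(0, σ ^ 2 * h i)`. -/
noncomputable def baseLaw {n : ℕ} (D : Matrix (Fin n) (Fin n) ℝ)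
    (h : Fin n → ℝ) (σ : ℝ) : Measure (Fin n → ℝ) :=
  (Measure.pi fun i => gaussianReal 0 (σ ^ 2 * h i).toNNReal).map fun z => D⁻¹.mulVec z

/-- The two parameterizations of the flexibility parameters: the variance-corrected pair `(η, μ)`
and the tail-corrected pair `(η⋆, μ⋆)`. -/
inductive Parameterization where
  | varianceCorrected
  | tailCorrected

/-- The first variance-corrected parameter `η`, as a function of the pair `(e, m)` of
flexibility parameters in the parameterization `par`. -/
noncomputable def Parameterization.eta (par : Parameterization) (kind : NoiseKind)
    (e m : ℝ) : ℝ :=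
  match par, kind with
  | .varianceCorrected, _ => e
  | .tailCorrected, .nig => e * (1 + m ^ 2 - |m| * Real.sqrt (1 + m ^ 2)) ^ 2
  | .tailCorrected, .gal => 1 / 2 * e * (1 + m ^ 2) * (Real.sqrt (2 + m ^ 2) - |m|) ^ 2

/-- The second variance-corrected parameter `μ`, as a function of the pair `(e, m)` of
flexibility parameters in the parameterization `par`; in the tail-corrected parameterization
`m = √η * μ`. -/
noncomputable def Parameterization.mu (par : Parameterization) (kind : NoiseKind)
    (e m : ℝ) : ℝ :=
  match par with
  | .varianceCorrected => m
  | .tailCorrected => m / Real.sqrt (par.eta kind e m)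

/-- Kullback-Leibler divergence of the symmetric flexible model, with flexibility parameters `e`
and `0` in the parameterization `par`, from the base Gaussian model. -/
noncomputable def symmetricKLD (par : Parameterization) (kind : NoiseKind) {n : ℕ}
    (D : Matrix (Fin n) (Fin n) ℝ) (h : Fin n → ℝ) (σ e : ℝ) : ENNReal :=
  InformationTheory.klDiv (flexibleLaw kind D h σ (par.eta kind e 0) (par.mu kind e 0))
    (baseLaw D h σ)

/-- `q` is the second-order expansion of `f` at `0` from the right. -/
def IsSecondOrderExpansion (f : ℝ → ℝ) (q : Polynomial ℝ) : Prop :=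
  q.natDegree ≤ 2 ∧
    (fun e => f e - q.eval e) =o[nhdsWithin 0 (Set.Ioi 0)] fun e => e ^ 2

/-- The distance `d = √(2 * KLD)`, for a divergence measured by the function `K`. -/
noncomputable def pcDistance (K : ℝ → ℝ) (e : ℝ) : ℝ := Real.sqrt (2 * K e)

/-- `P` is a penalized complexity prior on `[0, ∞)` for the distance `d` with rate `θ`: under `P`
the distance from the base model is exponentially distributed with rate `θ`. -/
def IsPCPrior (d : ℝ → ℝ) (θ : ℝ) (P : Measure ℝ) : Prop :=
  P (Set.Iio 0) = 0 ∧ P.map d = expMeasure θ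

/-- The penalized complexity prior density `θ * |d'(e)| * exp (-θ * d(e))` on `[0, ∞)`, with a
one-sided derivative at the base model `e = 0`. -/
noncomputable def pcPriorDensity (d : ℝ → ℝ) (θ e : ℝ) : ℝ :=
  if 0 ≤ e then θ * |derivWithin d (Set.Ici 0) e| * Real.exp (-(θ * d e)) else 0

/-! Kullback-Leibler divergence is invariant under measurable bijections and additive over
independent components. Hence `D` and `σ` drop out, and the divergence is a sum over `i` of
one-dimensional divergences of a mixture of `N(0, v)` from `N(0, 1)`, where the mixing variable has
been divided by `h i` and so has mean 1 and variance `t = η / h i` (`symmetricKLD_eq_sum`). It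
remains to show that each of these is `3/16 * t ^ 2 + O(t ^ 3)`.

Let `f` be the density of the mixture with respect to the standard Gaussian `γ`. The divergence is
`∫ klFun f dγ`, and `klFun x = (x - 1) ^ 2 / 2 + O(|x - 1| ^ 3)`. The quadratic term is explicit,
because the product of the density ratios of `N(0, v)` and `N(0, w)` has `γ`-integral `(1 - (v - 1)
* (w - 1)) ^ (-1/2)`. Expand this as `1 + x / 2 + 3 / 8 * x ^ 2 + O(x ^ 3)` with `x = (v - 1) * (w -
1)` and integrate over independent `v`, `w`: the linear term vanishes as the mean is 1, and what
remains is `1 / 2 * 3 / 8 * t ^ 2`. The cubic error is small since `f - 1` is pointwise `O(t)`, with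
a growth in `u` that stays `γ`-integrable after cubing.

These integrals need `v` close to 1: for large `v`, `w` the product is not even integrable. So the
mixing law is cut at `|v - 1| ≤ 1/8`. The discarded part changes `klFun f` by at most its own
density times a bound on `|log|`, which is quadratic in `u`; by the sixth central moment this costs
only `O(t ^ 3)` (`abs_klFun_mixDensity_sub_nearOne_le`, `exists_klDiv_bind_gaussianReal_bound`).

The moment bounds for both noise types follow from their moment generating functions, which
exponential tilting gives in closed form (`isConcentratedMixing_of_mgf`). The prior is then
elementary: the distance is linear on `[0, ∞)`, so an exponential law pulls back to a rescaled
exponential law. -/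

/-! ### Invariance and additivity of the Kullback-Leibler divergence -/

/-- Data processing inequality, applied to the map and to its inverse. -/
theorem klDiv_map_measurableEquiv {α β : Type*} [MeasurableSpace α] [MeasurableSpace β]
    (e : α ≃ᵐ β) (μ ν : Measure α) [IsFiniteMeasure μ] [IsFiniteMeasure ν] :
    InformationTheory.klDiv (μ.map e) (ν.map e) = InformationTheory.klDiv μ ν := by
  refine le_antisymm (InformationTheory.klDiv_map_le μ ν e.measurable) ?_
  have := InformationTheory.klDiv_map_le (μ.map e) (ν.map e) e.symm.measurable
  simpa using this

theorem klDiv_prod {α β : Type*} [MeasurableSpace α] [MeasurableSpace β]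
    (μ ν : Measure α) (μ' ν' : Measure β) [IsProbabilityMeasure μ] [IsProbabilityMeasure ν]
    [IsProbabilityMeasure μ'] [IsProbabilityMeasure ν'] :
    InformationTheory.klDiv (μ.prod μ') (ν.prod ν') =
      InformationTheory.klDiv μ ν + InformationTheory.klDiv μ' ν' := by
  rw [← Measure.compProd_const, ← Measure.compProd_const,
    InformationTheory.klDiv_compProd_eq_add, Measure.compProd_const, Measure.compProd_const]
  congr 1
  -- The chain rule leaves the divergence of `μ.prod μ'` from `μ.prod ν'`. Swapping the coordinates
  -- turns the common factor into a common kernel, which cancels.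
  rw [← klDiv_map_measurableEquiv MeasurableEquiv.prodComm]
  change InformationTheory.klDiv ((μ.prod μ').map Prod.swap) ((μ.prod ν').map Prod.swap) = _
  rw [Measure.prod_swap, Measure.prod_swap, ← Measure.compProd_const, ← Measure.compProd_const,
    InformationTheory.klDiv_compProd_left]

theorem klDiv_pi : ∀ {n : ℕ} (μ ν : Fin n → Measure ℝ) [∀ i, IsProbabilityMeasure (μ i)]
    [∀ i, IsProbabilityMeasure (ν i)],
    InformationTheory.klDiv (Measure.pi μ) (Measure.pi ν) =
      ∑ i, InformationTheory.klDiv (μ i) (ν i)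
  | 0, μ, ν, _, _ => by
    rw [Measure.pi_of_empty μ, Measure.pi_of_empty ν]; simp
  | n + 1, μ, ν, _, _ => by
    have h1 := (measurePreserving_piFinSuccAbove μ 0).map_eq
    have h2 := (measurePreserving_piFinSuccAbove ν 0).map_eq
    rw [← klDiv_map_measurableEquiv (MeasurableEquiv.piFinSuccAbove (fun _ => ℝ) 0), h1, h2,
      klDiv_prod, klDiv_pi, Fin.sum_univ_succ]
    simp

theorem klDiv_map_const_mul {c : ℝ} (hc : c ≠ 0) (μ ν : Measure ℝ) [IsFiniteMeasure μ]
    [IsFiniteMeasure ν] :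
    InformationTheory.klDiv (μ.map (c * ·)) (ν.map (c * ·)) = InformationTheory.klDiv μ ν :=
  klDiv_map_measurableEquiv (MeasurableEquiv.mulLeft₀ c hc) μ ν

theorem klDiv_map_mulVec {n : ℕ} {B : Matrix (Fin n) (Fin n) ℝ} (hB : IsUnit B.det)
    (μ ν : Measure (Fin n → ℝ)) [IsFiniteMeasure μ] [IsFiniteMeasure ν] :
    InformationTheory.klDiv (μ.map fun x => B.mulVec x) (ν.map fun x => B.mulVec x) =
      InformationTheory.klDiv μ ν := by
  have hm : ∀ C : Matrix (Fin n) (Fin n) ℝ, Measurable fun x => C.mulVec x := fun C =>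
    (Continuous.matrix_mulVec continuous_const continuous_id).measurable
  refine klDiv_map_measurableEquiv
    ⟨⟨fun x => B.mulVec x, fun x => B⁻¹.mulVec x, fun x => ?_, fun x => ?_⟩, hm _, hm _⟩ μ ν
  · simp [Matrix.mulVec_mulVec, Matrix.nonsing_inv_mul B hB]
  · simp [Matrix.mulVec_mulVec, Matrix.mul_nonsing_inv B hB]

/-! ### Gaussian density ratios and Taylor estimates -/

open InformationTheory (klFun klDiv)

/-- Density of `N(0, v)` with respect to `N(0, 1)`, at the point `u`. -/
noncomputable def gaussRatio (v u : ℝ) : ℝ :=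
  (Real.sqrt v)⁻¹ * Real.exp (u ^ 2 / 2 * (1 - 1 / v))

theorem gaussRatio_nonneg (v u : ℝ) : 0 ≤ gaussRatio v u := by
  unfold gaussRatio; positivity

theorem measurable_uncurry_gaussRatio : Measurable (Function.uncurry gaussRatio) := by
  unfold gaussRatio Function.uncurry
  fun_prop

theorem gaussRatio_le {v : ℝ} (hv : 0 < v) (u : ℝ) :
    gaussRatio v u ≤ (Real.sqrt v)⁻¹ * Real.exp (u ^ 2 / 2) := by
  unfold gaussRatio
  gcongr
  have : 0 < 1 / v := by positivity
  nlinarith [sq_nonneg u]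

theorem gaussianPDFReal_eq_mul_gaussRatio {v : ℝ} (hv : 0 < v) (u : ℝ) :
    gaussianPDFReal 0 v.toNNReal u = gaussianPDFReal 0 1 u * gaussRatio v u := by
  simp only [gaussianPDFReal, gaussRatio, Real.coe_toNNReal _ hv.le, NNReal.coe_one, sub_zero,
    mul_one]
  rw [Real.sqrt_mul (by positivity), mul_inv]
  have : Real.exp (-u ^ 2 / (2 * v)) =
      Real.exp (-u ^ 2 / 2) * Real.exp (u ^ 2 / 2 * (1 - 1 / v)) := by
    rw [← Real.exp_add]; congr 1; field_simp; ring
  rw [this]; ring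

theorem half_exp_le_gaussRatio {v : ℝ} (hv : |v - 1| ≤ 1 / 8) (u : ℝ) :
    1 / 2 * Real.exp (-(u ^ 2 / 2)) ≤ gaussRatio v u := by
  obtain ⟨h1, h2⟩ := abs_le.1 hv
  unfold gaussRatio
  have hs : 1 / 2 ≤ (Real.sqrt v)⁻¹ := by
    rw [one_div]
    refine inv_anti₀ (Real.sqrt_pos.2 (by linarith)) ?_
    rw [Real.sqrt_le_left (by norm_num)]; linarith
  have : -1 ≤ 1 - 1 / v := by
    have : 1 / v ≤ 2 := by rw [div_le_iff₀ (by linarith)]; linarith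
    linarith
  gcongr
  nlinarith [sq_nonneg u]

theorem gaussRatio_le_two_mul_exp {v : ℝ} (hv : |v - 1| ≤ 1 / 8) (u : ℝ) :
    gaussRatio v u ≤ 2 * Real.exp (u ^ 2 / 16) := by
  obtain ⟨h1, h2⟩ := abs_le.1 hv
  unfold gaussRatio
  have hs : (Real.sqrt v)⁻¹ ≤ 2 := by
    rw [inv_le_comm₀ (Real.sqrt_pos.2 (by linarith)) (by norm_num)]
    exact Real.le_sqrt_of_sq_le (by linarith)
  have : 1 - 1 / v ≤ 1 / 8 := by
    have : 7 / 8 ≤ 1 / v := by rw [le_div_iff₀ (by linarith)]; linarith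
    linarith
  gcongr
  nlinarith [sq_nonneg u]

theorem abs_exp_sub_one_sub_le (y : ℝ) :
    |Real.exp y - 1 - y| ≤ y ^ 2 * Real.exp |y| := by
  have := Complex.norm_exp_sub_sum_le_norm_mul_exp (y : ℂ) 2
  simp only [Finset.sum_range_succ, Finset.sum_range_zero, pow_zero, pow_one, Nat.factorial,
    Complex.norm_real, Real.norm_eq_abs, sq_abs] at this
  have e : Complex.exp y - (0 + 1 / ((1 : ℕ) : ℂ) + (y : ℂ) / (((0 + 1) * 1 : ℕ) : ℂ)) =
      ((Real.exp y - 1 - y : ℝ) : ℂ) := by push_cast; ring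
  rw [e, Complex.norm_real, Real.norm_eq_abs] at this
  exact this

/-- First-order Taylor expansion in `v` at 1. The ratio is `exp y` with `y = -log v / 2 + u ^ 2 / 2
* (s / v)` and `s = v - 1`; both `exp y - 1 - y` and the nonlinear part of `y` are quadratic in `s`.
The rate `1/14` is `4/7 * 1/8`, from the bound on `|y|`; it is small enough for later powers to stay
Gaussian integrable. -/
theorem abs_gaussRatio_sub_le {v : ℝ} (hv : |v - 1| ≤ 1 / 8) (u : ℝ) :
    |gaussRatio v u - 1 - (v - 1) * ((u ^ 2 - 1) / 2)| ≤
      (v - 1) ^ 2 * (2 * (1 + u ^ 2) ^ 2 * Real.exp ((1 + u ^ 2) / 14)) := by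
  set s := v - 1 with hs
  have hvs : v = 1 + s := by rw [hs]; ring
  obtain ⟨h1, h2⟩ := abs_le.1 hv
  have hv0 : 0 < v := by linarith
  have hne : 1 + s ≠ 0 := by rw [← hvs]; exact hv0.ne'
  set y := -(Real.log v / 2) + u ^ 2 / 2 * (s / v) with hy
  have hf : gaussRatio v u = Real.exp y := by
    unfold gaussRatio
    rw [hy, Real.exp_add, Real.exp_neg, Real.exp_half, Real.exp_log hv0]
    congr 3
    rw [hvs]; field_simp; ring
  have hsv : |s / v| ≤ 8 / 7 * |s| := by
    rw [abs_div, abs_of_pos hv0, div_le_iff₀ hv0]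
    nlinarith [abs_nonneg s]
  have hlog : |Real.log v - s| ≤ 8 / 7 * s ^ 2 := by
    have hl := Real.one_sub_inv_le_log_of_pos hv0
    have hu := Real.log_le_sub_one_of_pos hv0
    have : 1 - v⁻¹ = s - s ^ 2 / v := by rw [hvs]; field_simp; ring
    have h3 : s ^ 2 / v ≤ 8 / 7 * s ^ 2 := by
      rw [div_le_iff₀ hv0]; nlinarith [sq_nonneg s]
    rw [abs_le]; constructor <;> nlinarith [sq_nonneg s]
  have hdiv : |s / v - s| ≤ 8 / 7 * s ^ 2 := by
    have : s / v - s = -(s ^ 2 / v) := by rw [hvs]; field_simp; ring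
    rw [this, abs_neg, abs_of_nonneg (by positivity), div_le_iff₀ hv0]
    nlinarith [sq_nonneg s]
  have hy1 : |y - s * ((u ^ 2 - 1) / 2)| ≤ s ^ 2 * (1 + u ^ 2) := by
    have : y - s * ((u ^ 2 - 1) / 2) =
        -((Real.log v - s) / 2) + u ^ 2 / 2 * (s / v - s) := by rw [hy]; ring
    rw [this]
    refine (abs_add_le _ _).trans ?_
    rw [abs_neg, abs_div, abs_mul, abs_of_nonneg (by positivity : 0 ≤ u ^ 2 / 2), abs_two]
    nlinarith [sq_nonneg s, sq_nonneg u, mul_nonneg (sq_nonneg s) (sq_nonneg u),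
      mul_le_mul_of_nonneg_left hdiv (by positivity : 0 ≤ u ^ 2 / 2)]
  have hy2 : |y| ≤ 4 / 7 * |s| * (1 + u ^ 2) := by
    have hl : |Real.log v| ≤ 8 / 7 * |s| := by
      have hl := Real.one_sub_inv_le_log_of_pos hv0
      have hu := Real.log_le_sub_one_of_pos hv0
      have : 1 - v⁻¹ = s / v := by rw [hvs]; field_simp; ring
      rw [this] at hl
      have := neg_abs_le (s / v)
      rw [abs_le]
      constructor
      · linarith
      · linarith [le_abs_self s, abs_nonneg s]
    rw [hy]
    refine (abs_add_le _ _).trans ?_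
    rw [abs_neg, abs_div, abs_mul, abs_of_nonneg (by positivity : 0 ≤ u ^ 2 / 2), abs_two]
    nlinarith [mul_le_mul_of_nonneg_left hsv (by positivity : 0 ≤ u ^ 2 / 2)]
  have hexp : |Real.exp y - 1 - y| ≤ s ^ 2 * ((1 + u ^ 2) ^ 2 * Real.exp ((1 + u ^ 2) / 14)) := by
    refine (abs_exp_sub_one_sub_le y).trans ?_
    have a1 : y ^ 2 ≤ s ^ 2 * (1 + u ^ 2) ^ 2 := by
      rw [← sq_abs y, ← sq_abs s, ← mul_pow]
      refine pow_le_pow_left₀ (abs_nonneg _) (hy2.trans ?_) 2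
      nlinarith [abs_nonneg s, mul_nonneg (abs_nonneg s) (by positivity : 0 ≤ 1 + u ^ 2)]
    have a2 : |y| ≤ (1 + u ^ 2) / 14 := hy2.trans (by nlinarith [sq_nonneg u])
    rw [← mul_assoc]
    gcongr
  have he : 1 ≤ Real.exp ((1 + u ^ 2) / 14) := Real.one_le_exp (by positivity)
  rw [hf]
  calc |Real.exp y - 1 - s * ((u ^ 2 - 1) / 2)|
      = |(Real.exp y - 1 - y) + (y - s * ((u ^ 2 - 1) / 2))| := by ring_nf
    _ ≤ s ^ 2 * ((1 + u ^ 2) ^ 2 * Real.exp ((1 + u ^ 2) / 14)) + s ^ 2 * (1 + u ^ 2) :=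
        (abs_add_le _ _).trans (add_le_add hexp hy1)
    _ ≤ _ := by
      have : 1 + u ^ 2 ≤ (1 + u ^ 2) ^ 2 * Real.exp ((1 + u ^ 2) / 14) := by
        nlinarith [sq_nonneg u, mul_nonneg (sq_nonneg (1 + u ^ 2)) (sub_nonneg.2 he)]
      nlinarith [sq_nonneg s, mul_le_mul_of_nonneg_left this (sq_nonneg s)]

theorem klFun_le_sq {x : ℝ} (hx : 0 ≤ x) : klFun x ≤ (x - 1) ^ 2 := by
  rcases hx.eq_or_lt with rfl | hx
  · simp [InformationTheory.klFun_apply]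
  · rw [InformationTheory.klFun_apply]
    nlinarith [Real.log_le_sub_one_of_pos hx]

/-- Near 1 this is the Taylor series of the logarithm. Away from 1 both terms on the left are at
most a multiple of `(x - 1) ^ 2`, which the cube dominates there. -/
theorem abs_klFun_sub_le {x : ℝ} (hx : 0 ≤ x) :
    |klFun x - (x - 1) ^ 2 / 2| ≤ 4 * |x - 1| ^ 3 := by
  set ε := x - 1 with hε
  have hxε : x = 1 + ε := by rw [hε]; ring
  by_cases h : |ε| ≤ 1 / 2
  · have h1 := Real.abs_log_sub_add_sum_range_le (x := -ε) (by rw [abs_neg]; linarith) 2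
    simp only [Finset.sum_range_succ, Finset.sum_range_zero, abs_neg, Nat.reduceAdd] at h1
    have h2 : |Real.log x - ε + ε ^ 2 / 2| ≤ 2 * |ε| ^ 3 := by
      have e : (0 + (-ε) ^ (0 + 1) / (((0 : ℕ) : ℝ) + 1) + (-ε) ^ 2 / (((1 : ℕ) : ℝ) + 1) +
          Real.log (1 - -ε)) = Real.log x - ε + ε ^ 2 / 2 := by
        rw [hxε, sub_neg_eq_add]; push_cast; ring
      rw [e] at h1
      refine h1.trans ?_
      rw [div_le_iff₀ (by linarith)]
      nlinarith [pow_nonneg (abs_nonneg ε) 3]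
    have e : klFun x - ε ^ 2 / 2 =
        (1 + ε) * (Real.log x - ε + ε ^ 2 / 2) - ε ^ 3 / 2 := by
      rw [InformationTheory.klFun_apply, hxε]; ring
    rw [e]
    refine (abs_sub _ _).trans ?_
    rw [abs_mul, abs_div, abs_pow, abs_two]
    have : |1 + ε| ≤ 3 / 2 := (abs_add_le _ _).trans (by rw [abs_one]; linarith)
    nlinarith [pow_nonneg (abs_nonneg ε) 3, abs_nonneg (1 + ε),
      mul_le_mul this h2 (abs_nonneg _) (by norm_num)]
  · have h1 := klFun_le_sq hx
    have h2 := InformationTheory.klFun_nonneg hx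
    push Not at h
    rw [← hε] at h1
    have : ε ^ 2 / 2 ≤ |ε| ^ 3 := by
      rw [← sq_abs]; nlinarith [sq_nonneg |ε|]
    have h3 := pow_nonneg (abs_nonneg ε) 3
    rw [abs_le]; constructor <;> linarith

/-- A mean value bound, since the derivative of `klFun` is `log`; the elementary inequalities for
`log` replace differentiation. -/
theorem abs_klFun_add_sub_klFun_le {a d B : ℝ} (ha : 0 < a) (hd : 0 ≤ d) (h1 : |Real.log a| ≤ B)
    (h2 : |Real.log (a + d)| ≤ B) : |klFun (a + d) - klFun a| ≤ B * d := by
  have hb : 0 < a + d := by linarith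
  have l1 : Real.log (a + d) - Real.log a ≤ d / a := by
    rw [← Real.log_div hb.ne' ha.ne']
    refine (Real.log_le_sub_one_of_pos (by positivity)).trans (le_of_eq ?_)
    field_simp
    ring
  have l2 : d / (a + d) ≤ Real.log (a + d) - Real.log a := by
    rw [← Real.log_div hb.ne' ha.ne']
    refine le_trans (le_of_eq ?_) (Real.one_sub_inv_le_log_of_pos (by positivity))
    field_simp; ring
  rw [le_div_iff₀ ha] at l1
  rw [div_le_iff₀ hb] at l2
  rw [abs_le] at h1 h2 ⊢
  simp only [InformationTheory.klFun_apply]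
  constructor <;> nlinarith

theorem abs_inv_sqrt_one_sub_sub_le {x : ℝ} (hx : |x| ≤ 1 / 2) :
    |(Real.sqrt (1 - x))⁻¹ - 1 - x / 2 - 3 / 8 * x ^ 2| ≤ 2 * |x| ^ 3 := by
  obtain ⟨h1, h2⟩ := abs_le.1 hx
  set w := Real.sqrt (1 - x) with hw
  have hw2 : w ^ 2 = 1 - x := Real.sq_sqrt (by linarith)
  have hwh : 1 / 2 ≤ w := Real.le_sqrt_of_sq_le (by linarith)
  have hw0 : 0 < w := by linarith
  have hxw : x = 1 - w ^ 2 := by linarith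
  -- In terms of `w = √(1 - x)` the Taylor remainder is rational and the factor `x ^ 3` splits off
  -- exactly.
  have e : w⁻¹ - 1 - x / 2 - 3 / 8 * x ^ 2 =
      x ^ 3 * ((8 + 9 * w + 3 * w ^ 2) / (8 * w * (1 + w) ^ 3)) := by
    rw [hxw]; field_simp; ring
  rw [e, abs_mul, abs_pow, abs_of_nonneg (a := _ / _) (by positivity), mul_comm 2]
  gcongr
  rw [div_le_iff₀ (by positivity)]
  nlinarith [pow_pos hw0 2, pow_pos hw0 3]

/-- A Gaussian integral with rate `(1 / v + 1 / w - 1) / 2`. Its positivity is what forces `v` and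
`w` to stay away from large values. -/
theorem integral_gaussRatio_mul_gaussRatio {v w : ℝ} (hv : |v - 1| ≤ 1 / 8)
    (hw : |w - 1| ≤ 1 / 8) :
    ∫ u, gaussRatio v u * gaussRatio w u ∂(gaussianReal 0 1) =
      (Real.sqrt (1 - (v - 1) * (w - 1)))⁻¹ := by
  obtain ⟨h1, h2⟩ := abs_le.1 hv
  obtain ⟨h3, h4⟩ := abs_le.1 hw
  have hv0 : 0 < v := by linarith
  have hw0 : 0 < w := by linarith
  have hb : 0 < (1 / v + 1 / w - 1) / 2 := by
    have : 7 / 8 ≤ 1 / v := by rw [le_div_iff₀ hv0]; linarith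
    have : 7 / 8 ≤ 1 / w := by rw [le_div_iff₀ hw0]; linarith
    linarith
  rw [integral_gaussianReal_eq_integral_smul one_ne_zero]
  have : ∀ u, gaussianPDFReal 0 1 u • (gaussRatio v u * gaussRatio w u) =
      ((Real.sqrt (2 * Real.pi))⁻¹ * (Real.sqrt v)⁻¹ * (Real.sqrt w)⁻¹) *
        Real.exp (-((1 / v + 1 / w - 1) / 2) * u ^ 2) := by
    intro u
    simp only [gaussianPDFReal, gaussRatio, NNReal.coe_one, sub_zero, mul_one, smul_eq_mul]
    have : Real.exp (-((1 / v + 1 / w - 1) / 2) * u ^ 2) = Real.exp (-u ^ 2 / 2) *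
      (Real.exp (u ^ 2 / 2 * (1 - 1 / v)) * Real.exp (u ^ 2 / 2 * (1 - 1 / w))) := by
      rw [← Real.exp_add, ← Real.exp_add]; congr 1; ring
    rw [this]; ring
  simp_rw [this]
  rw [integral_const_mul, integral_gaussian, ← Real.sqrt_inv, ← Real.sqrt_inv, ← Real.sqrt_inv,
    ← Real.sqrt_inv, ← Real.sqrt_mul (by positivity), ← Real.sqrt_mul (by positivity),
    ← Real.sqrt_mul (by positivity)]
  congr 1
  have : 1 - (v - 1) * (w - 1) = v * w * (1 / v + 1 / w - 1) := by field_simp; ring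
  rw [this]
  have := Real.pi_pos
  field_simp

/-! ### Gaussian variance mixtures and their densities -/

theorem measurable_gaussianReal_toNNReal :
    Measurable fun v : ℝ => gaussianReal 0 v.toNNReal :=
  measurable_gaussianReal.comp (measurable_const.prodMk measurable_real_toNNReal)

theorem measurable_gaussRatio_right (v : ℝ) : Measurable (gaussRatio v) :=
  measurable_uncurry_gaussRatio.comp measurable_prodMk_left

theorem measurable_gaussRatio_left (u : ℝ) : Measurable fun v => gaussRatio v u :=
  measurable_uncurry_gaussRatio.comp measurable_prodMk_right

theorem gaussianReal_eq_withDensity_gaussRatio {v : ℝ} (hv : 0 < v) :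
    gaussianReal 0 v.toNNReal =
      (gaussianReal 0 1).withDensity fun u => ENNReal.ofReal (gaussRatio v u) := by
  rw [gaussianReal_of_var_ne_zero 0 one_ne_zero, gaussianReal_of_var_ne_zero 0 (by simpa using hv),
    ← withDensity_mul _ (measurable_gaussianPDF _ _) (measurable_gaussRatio_right v).ennreal_ofReal]
  congr 1
  ext u
  rw [gaussianPDF, Pi.mul_apply, gaussianPDF, ← ENNReal.ofReal_mul (gaussianPDFReal_nonneg _ _ _),
    gaussianPDFReal_eq_mul_gaussRatio hv]

theorem bind_gaussianReal_eq_withDensity (ν : Measure ℝ) [SFinite ν] (hpos : ∀ᵐ v ∂ν, 0 < v) :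
    (ν.bind fun v => gaussianReal 0 v.toNNReal) =
      (gaussianReal 0 1).withDensity fun u => ∫⁻ v, ENNReal.ofReal (gaussRatio v u) ∂ν := by
  ext s hs
  rw [Measure.bind_apply hs measurable_gaussianReal_toNNReal.aemeasurable,
    withDensity_apply _ hs, lintegral_lintegral_swap]
  · refine lintegral_congr_ae ?_
    filter_upwards [hpos] with v hv
    rw [gaussianReal_eq_withDensity_gaussRatio hv, withDensity_apply _ hs]
  · exact (measurable_uncurry_gaussRatio.comp measurable_swap).ennreal_ofReal.aemeasurable

/-- Density with respect to `N(0, 1)` of the mixture of the laws `N(0, v)` under `ν`. -/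
noncomputable def mixDensity (ν : Measure ℝ) (u : ℝ) : ℝ := ∫ v, gaussRatio v u ∂ν

theorem mixDensity_nonneg (ν : Measure ℝ) (u : ℝ) : 0 ≤ mixDensity ν u :=
  integral_nonneg fun v => gaussRatio_nonneg v u

theorem measurable_mixDensity (ν : Measure ℝ) [SFinite ν] : Measurable (mixDensity ν) :=
  (StronglyMeasurable.integral_prod_left
    (f := gaussRatio) measurable_uncurry_gaussRatio.stronglyMeasurable).measurable

theorem integrable_gaussRatio {ν : Measure ℝ} (hpos : ∀ᵐ v ∂ν, 0 < v)
    (hI : Integrable (fun v => (Real.sqrt v)⁻¹) ν) (u : ℝ) :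
    Integrable (fun v => gaussRatio v u) ν := by
  refine (hI.mul_const (Real.exp (u ^ 2 / 2))).mono'
    (measurable_gaussRatio_left u).aestronglyMeasurable ?_
  filter_upwards [hpos] with v hv
  rw [Real.norm_of_nonneg (gaussRatio_nonneg v u)]
  exact gaussRatio_le hv u

theorem mixDensity_le {ν : Measure ℝ} (hpos : ∀ᵐ v ∂ν, 0 < v)
    (hI : Integrable (fun v => (Real.sqrt v)⁻¹) ν) (u : ℝ) :
    mixDensity ν u ≤ (∫ v, (Real.sqrt v)⁻¹ ∂ν) * Real.exp (u ^ 2 / 2) := by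
  rw [← integral_mul_const]
  refine integral_mono_ae (integrable_gaussRatio hpos hI u) (hI.mul_const _) ?_
  filter_upwards [hpos] with v hv using gaussRatio_le hv u

theorem bind_gaussianReal_eq_withDensity_mixDensity {ν : Measure ℝ} [SFinite ν]
    (hpos : ∀ᵐ v ∂ν, 0 < v) (hI : Integrable (fun v => (Real.sqrt v)⁻¹) ν) :
    (ν.bind fun v => gaussianReal 0 v.toNNReal) =
      (gaussianReal 0 1).withDensity fun u => ENNReal.ofReal (mixDensity ν u) := by
  rw [bind_gaussianReal_eq_withDensity ν hpos]
  congr 1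
  ext u
  rw [mixDensity, ofReal_integral_eq_lintegral_ofReal (integrable_gaussRatio hpos hI u)
    (Filter.Eventually.of_forall fun v => gaussRatio_nonneg v u)]

instance isProbabilityMeasure_bind_gaussianReal (ν : Measure ℝ) [IsProbabilityMeasure ν] :
    IsProbabilityMeasure (ν.bind fun v => gaussianReal 0 v.toNNReal) :=
  isProbabilityMeasure_bind measurable_gaussianReal_toNNReal.aemeasurable
    (Filter.Eventually.of_forall fun _ => inferInstance)

theorem klDiv_bind_gaussianReal {ν : Measure ℝ} [IsProbabilityMeasure ν]
    (hpos : ∀ᵐ v ∂ν, 0 < v) (hI : Integrable (fun v => (Real.sqrt v)⁻¹) ν)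
    (hk : Integrable (fun u => klFun (mixDensity ν u)) (gaussianReal 0 1)) :
    klDiv (ν.bind fun v => gaussianReal 0 v.toNNReal) (gaussianReal 0 1) ≠ ⊤ ∧
    (klDiv (ν.bind fun v => gaussianReal 0 v.toNNReal) (gaussianReal 0 1)).toReal =
      ∫ u, klFun (mixDensity ν u) ∂(gaussianReal 0 1) := by
  have hm := bind_gaussianReal_eq_withDensity_mixDensity hpos hI
  have hac : (ν.bind fun v => gaussianReal 0 v.toNNReal) ≪ gaussianReal 0 1 := by
    rw [hm]; exact withDensity_absolutelyContinuous _ _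
  have hr : (fun u => klFun (((ν.bind fun v => gaussianReal 0 v.toNNReal).rnDeriv
      (gaussianReal 0 1) u).toReal)) =ᵐ[gaussianReal 0 1] fun u => klFun (mixDensity ν u) := by
    have := Measure.rnDeriv_withDensity (gaussianReal 0 1)
      (measurable_mixDensity ν).ennreal_ofReal
    rw [← hm] at this
    filter_upwards [this] with u hu
    rw [hu, ENNReal.toReal_ofReal (mixDensity_nonneg ν u)]
  refine ⟨InformationTheory.klDiv_ne_top hac ?_, ?_⟩
  · exact (InformationTheory.integrable_klFun_rnDeriv_iff hac).1 ((integrable_congr hr).2 hk)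
  · rw [InformationTheory.toReal_klDiv_eq_integral_klFun hac, integral_congr_ae hr]

theorem integrable_one_add_sq_mul_gaussRatio {v : ℝ} (hv : 0 < v) :
    Integrable (fun u => (1 + u ^ 2) * gaussRatio v u) (gaussianReal 0 1) ∧
      ∫ u, (1 + u ^ 2) * gaussRatio v u ∂(gaussianReal 0 1) = 1 + v := by
  have hsq : Integrable (fun u : ℝ => u ^ 2) (gaussianReal 0 v.toNNReal) := by
    simpa using (memLp_id_gaussianReal (μ := 0) (v := v.toNNReal) 2).integrable_sq
  have h1 : Integrable (fun u : ℝ => 1 + u ^ 2) (gaussianReal 0 v.toNNReal) :=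
    (integrable_const 1).add hsq
  have h2 : ∫ u, (1 + u ^ 2) ∂(gaussianReal 0 v.toNNReal) = 1 + v := by
    rw [integral_add (integrable_const 1) hsq]
    have := variance_fun_id_gaussianReal (μ := 0) (v := v.toNNReal)
    rw [variance_eq_integral measurable_id'.aemeasurable] at this
    simp only [integral_id_gaussianReal, sub_zero, Real.coe_toNNReal _ hv.le] at this
    rw [this]; simp
  rw [gaussianReal_eq_withDensity_gaussRatio hv] at h1 h2
  rw [integrable_withDensity_iff (measurable_gaussRatio_right v).ennreal_ofReal
    (Filter.Eventually.of_forall fun _ => ENNReal.ofReal_lt_top)] at h1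
  rw [integral_withDensity_eq_integral_toReal_smul
    (measurable_gaussRatio_right v).ennreal_ofReal
    (Filter.Eventually.of_forall fun _ => ENNReal.ofReal_lt_top)] at h2
  simp only [ENNReal.toReal_ofReal (gaussRatio_nonneg v _), smul_eq_mul] at h1 h2
  exact ⟨h1, by simpa only [mul_comm] using h2⟩

/-- By Fubini, as `N(0, v)` has second moment `v`. The weight `1 + u ^ 2` is the one with which the
discarded part of the mixing law enters. -/
theorem integral_one_add_sq_mul_mixDensity {ν : Measure ℝ} [IsFiniteMeasure ν]
    (hpos : ∀ᵐ v ∂ν, 0 < v) (h1 : Integrable (fun v => 1 + v) ν) :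
    Integrable (fun u => (1 + u ^ 2) * mixDensity ν u) (gaussianReal 0 1) ∧
      ∫ u, (1 + u ^ 2) * mixDensity ν u ∂(gaussianReal 0 1) = ∫ v, (1 + v) ∂ν := by
  have hm : Measurable (Function.uncurry fun v u : ℝ => (1 + u ^ 2) * gaussRatio v u) :=
    (by fun_prop : Measurable fun p : ℝ × ℝ => 1 + p.2 ^ 2).mul measurable_uncurry_gaussRatio
  have hF : Integrable (Function.uncurry fun v u : ℝ => (1 + u ^ 2) * gaussRatio v u)
      (ν.prod (gaussianReal 0 1)) := by
    rw [integrable_prod_iff hm.aestronglyMeasurable]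
    refine ⟨?_, ?_⟩
    · filter_upwards [hpos] with v hv using (integrable_one_add_sq_mul_gaussRatio hv).1
    · refine h1.congr ?_
      filter_upwards [hpos] with v hv
      rw [← (integrable_one_add_sq_mul_gaussRatio hv).2]
      refine integral_congr_ae (Filter.Eventually.of_forall fun u => ?_)
      have := gaussRatio_nonneg v u
      exact (Real.norm_of_nonneg (by positivity)).symm
  have e : ∀ u, (1 + u ^ 2) * mixDensity ν u = ∫ v, (1 + u ^ 2) * gaussRatio v u ∂ν := fun u =>
    (integral_const_mul _ _).symm
  simp_rw [e]
  refine ⟨hF.integral_prod_right, ?_⟩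
  rw [← integral_integral_swap hF]
  refine integral_congr_ae ?_
  filter_upwards [hpos] with v hv using (integrable_one_add_sq_mul_gaussRatio hv).2

theorem integral_mixDensity {ν : Measure ℝ} [IsFiniteMeasure ν] (hpos : ∀ᵐ v ∂ν, 0 < v) :
    Integrable (mixDensity ν) (gaussianReal 0 1) ∧
      ∫ u, mixDensity ν u ∂(gaussianReal 0 1) = ν.real Set.univ := by
  have h1 : ∀ v, 0 < v → Integrable (gaussRatio v) (gaussianReal 0 1) ∧
      ∫ u, gaussRatio v u ∂(gaussianReal 0 1) = 1 := by
    intro v hv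
    have h1 : Integrable (fun _ : ℝ => (1 : ℝ)) (gaussianReal 0 v.toNNReal) := integrable_const 1
    have h2 : ∫ _, (1 : ℝ) ∂(gaussianReal 0 v.toNNReal) = 1 := by simp
    rw [gaussianReal_eq_withDensity_gaussRatio hv] at h1 h2
    rw [integrable_withDensity_iff (measurable_gaussRatio_right v).ennreal_ofReal
      (Filter.Eventually.of_forall fun _ => ENNReal.ofReal_lt_top)] at h1
    rw [integral_withDensity_eq_integral_toReal_smul
      (measurable_gaussRatio_right v).ennreal_ofReal
      (Filter.Eventually.of_forall fun _ => ENNReal.ofReal_lt_top)] at h2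
    simp only [ENNReal.toReal_ofReal (gaussRatio_nonneg v _), smul_eq_mul, one_mul,
      mul_one] at h1 h2
    exact ⟨h1, h2⟩
  have hF : Integrable (Function.uncurry gaussRatio) (ν.prod (gaussianReal 0 1)) := by
    rw [integrable_prod_iff measurable_uncurry_gaussRatio.aestronglyMeasurable]
    refine ⟨?_, ?_⟩
    · filter_upwards [hpos] with v hv using (h1 v hv).1
    · refine (integrable_const (1 : ℝ)).congr ?_
      filter_upwards [hpos] with v hv
      rw [← (h1 v hv).2]
      refine integral_congr_ae (Filter.Eventually.of_forall fun u => ?_)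
      exact (Real.norm_of_nonneg (gaussRatio_nonneg v u)).symm
  refine ⟨hF.integral_prod_right, ?_⟩
  unfold mixDensity
  rw [← integral_integral_swap hF, integral_congr_ae (g := fun _ => (1 : ℝ))]
  · simp
  · filter_upwards [hpos] with v hv using (h1 v hv).2

theorem integrable_exp_mul_sq_gaussianReal {b : ℝ} (hb : b < 1 / 2) :
    Integrable (fun u => Real.exp (b * u ^ 2)) (gaussianReal 0 1) := by
  rw [gaussianReal_of_var_ne_zero 0 one_ne_zero, integrable_withDensity_iff
    (measurable_gaussianPDF _ _) (Filter.Eventually.of_forall fun _ => gaussianPDF_lt_top)]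
  refine ((integrable_exp_neg_mul_sq (b := 1 / 2 - b) (by linarith)).const_mul
    (Real.sqrt (2 * Real.pi))⁻¹).congr (Filter.Eventually.of_forall fun u => ?_)
  simp only [toReal_gaussianPDF, gaussianPDFReal, NNReal.coe_one, sub_zero, mul_one]
  rw [mul_left_comm, ← Real.exp_add]
  congr 2; ring

/-! ### Mixing measures supported near 1, of arbitrary finite mass -/

theorem ae_pos_of_ae_abs_sub_one_le {ρ : Measure ℝ} (hρ : ∀ᵐ v ∂ρ, |v - 1| ≤ 1 / 8) :
    ∀ᵐ v ∂ρ, 0 < v := by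
  filter_upwards [hρ] with v hv
  linarith [(abs_le.1 hv).1]

section Concentrated

variable {ρ : Measure ℝ} [IsFiniteMeasure ρ]

theorem integrable_gaussRatio_of_concentrated (hρ : ∀ᵐ v ∂ρ, |v - 1| ≤ 1 / 8) (u : ℝ) :
    Integrable (fun v => gaussRatio v u) ρ := by
  refine (integrable_const (2 * Real.exp (u ^ 2 / 16))).mono'
    (measurable_gaussRatio_left u).aestronglyMeasurable ?_
  filter_upwards [hρ] with v hv
  rw [Real.norm_of_nonneg (gaussRatio_nonneg v u)]
  exact gaussRatio_le_two_mul_exp hv u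

theorem integrable_sub_one_pow (hρ : ∀ᵐ v ∂ρ, |v - 1| ≤ 1 / 8) (k : ℕ) :
    Integrable (fun v : ℝ => (v - 1) ^ k) ρ := by
  refine (integrable_const ((1 / 8 : ℝ) ^ k)).mono' (by fun_prop) ?_
  filter_upwards [hρ] with v hv
  rw [norm_pow, Real.norm_eq_abs]
  gcongr

theorem integral_mixDensity_sq (hρ : ∀ᵐ v ∂ρ, |v - 1| ≤ 1 / 8) :
    Integrable (fun u => mixDensity ρ u ^ 2) (gaussianReal 0 1) ∧
      ∫ u, mixDensity ρ u ^ 2 ∂(gaussianReal 0 1) =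
        ∫ p : ℝ × ℝ, (Real.sqrt (1 - (p.1 - 1) * (p.2 - 1)))⁻¹ ∂(ρ.prod ρ) := by
  have hp : ∀ᵐ p ∂(ρ.prod ρ), |p.1 - 1| ≤ 1 / 8 ∧ |p.2 - 1| ≤ 1 / 8 :=
    (Measure.quasiMeasurePreserving_fst.ae hρ).and (Measure.quasiMeasurePreserving_snd.ae hρ)
  have hm : Measurable fun q : (ℝ × ℝ) × ℝ => gaussRatio q.1.1 q.2 * gaussRatio q.1.2 q.2 :=
    (measurable_uncurry_gaussRatio.comp (by fun_prop : Measurable fun q : (ℝ × ℝ) × ℝ =>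
      (q.1.1, q.2))).mul (measurable_uncurry_gaussRatio.comp
        (by fun_prop : Measurable fun q : (ℝ × ℝ) × ℝ => (q.1.2, q.2)))
  have hF : Integrable (Function.uncurry fun (p : ℝ × ℝ) u => gaussRatio p.1 u * gaussRatio p.2 u)
      ((ρ.prod ρ).prod (gaussianReal 0 1)) := by
    have hb : Integrable (fun q : (ℝ × ℝ) × ℝ => (4 : ℝ) * Real.exp (1 / 8 * q.2 ^ 2))
        ((ρ.prod ρ).prod (gaussianReal 0 1)) :=
      (integrable_const (4 : ℝ)).mul_prod
        (integrable_exp_mul_sq_gaussianReal (by norm_num : (1 / 8 : ℝ) < 1 / 2))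
    refine hb.mono' hm.aestronglyMeasurable ?_
    filter_upwards [Measure.quasiMeasurePreserving_fst.ae hp] with q hq
    have a1 := gaussRatio_le_two_mul_exp hq.1 q.2
    have a2 := gaussRatio_le_two_mul_exp hq.2 q.2
    have b1 := gaussRatio_nonneg q.1.1 q.2
    have b2 := gaussRatio_nonneg q.1.2 q.2
    have : (4 : ℝ) * Real.exp (1 / 8 * q.2 ^ 2) =
        (2 * Real.exp (q.2 ^ 2 / 16)) * (2 * Real.exp (q.2 ^ 2 / 16)) := by
      rw [mul_mul_mul_comm, ← Real.exp_add]; norm_num; ring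
    rw [this, Function.uncurry, Real.norm_of_nonneg (by positivity)]
    gcongr
  have e : ∀ u, mixDensity ρ u ^ 2 =
      ∫ p : ℝ × ℝ, gaussRatio p.1 u * gaussRatio p.2 u ∂(ρ.prod ρ) := fun u => by
    rw [integral_prod_mul (fun v => gaussRatio v u) (fun v => gaussRatio v u), sq]; rfl
  simp_rw [e]
  refine ⟨hF.integral_prod_right, ?_⟩
  rw [← integral_integral_swap hF]
  refine integral_congr_ae ?_
  filter_upwards [hp] with p hp using integral_gaussRatio_mul_gaussRatio hp.1 hp.2

/-- Integrate the expansion of `(1 - x) ^ (-1/2)` at `x = (v - 1) * (w - 1)` over the product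
measure: every monomial factors into moments. Total mass and first moment remain in the formula
because truncation moves them slightly away from 1 and 0. -/
theorem abs_integral_mixDensity_sub_one_sq_sub_le (hρ : ∀ᵐ v ∂ρ, |v - 1| ≤ 1 / 8) :
    Integrable (fun u => (mixDensity ρ u - 1) ^ 2) (gaussianReal 0 1) ∧
    |∫ u, (mixDensity ρ u - 1) ^ 2 ∂(gaussianReal 0 1) -
      ((1 - ρ.real Set.univ) ^ 2 + 1 / 2 * (∫ v, (v - 1) ∂ρ) ^ 2 +
        3 / 8 * (∫ v, (v - 1) ^ 2 ∂ρ) ^ 2)| ≤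
      2 * ((∫ v, (v - 1) ^ 2 ∂ρ) * ∫ v, (v - 1) ^ 4 ∂ρ) := by
  obtain ⟨i2, e2⟩ := integral_mixDensity_sq hρ
  obtain ⟨i1, e1⟩ := integral_mixDensity (ae_pos_of_ae_abs_sub_one_le hρ)
  have hexp : (fun u => (mixDensity ρ u - 1) ^ 2) =
      fun u => mixDensity ρ u ^ 2 - 2 * mixDensity ρ u + 1 := by ext u; ring
  have hp : ∀ᵐ p ∂(ρ.prod ρ), |p.1 - 1| ≤ 1 / 8 ∧ |p.2 - 1| ≤ 1 / 8 :=
    (Measure.quasiMeasurePreserving_fst.ae hρ).and (Measure.quasiMeasurePreserving_snd.ae hρ)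
  have i3 : Integrable (fun u => mixDensity ρ u ^ 2 - 2 * mixDensity ρ u) (gaussianReal 0 1) :=
    i2.sub (i1.const_mul 2)
  refine ⟨by rw [hexp]; exact i3.add (integrable_const 1), ?_⟩
  have hpow : ∀ j k : ℕ, Integrable (fun p : ℝ × ℝ => (p.1 - 1) ^ j * (p.2 - 1) ^ k)
      (ρ.prod ρ) := fun j k =>
    (integrable_sub_one_pow hρ j).mul_prod (integrable_sub_one_pow hρ k)
  have hint : ∀ j k : ℕ, ∫ p : ℝ × ℝ, (p.1 - 1) ^ j * (p.2 - 1) ^ k ∂(ρ.prod ρ) =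
      (∫ v, (v - 1) ^ j ∂ρ) * ∫ v, (v - 1) ^ k ∂ρ := fun j k =>
    integral_prod_mul (fun v => (v - 1) ^ j) (fun v => (v - 1) ^ k)
  set R : ℝ × ℝ → ℝ := fun p => (Real.sqrt (1 - (p.1 - 1) * (p.2 - 1)))⁻¹ - 1 -
    ((p.1 - 1) * (p.2 - 1)) / 2 - 3 / 8 * ((p.1 - 1) * (p.2 - 1)) ^ 2 with hR
  have hRle : ∀ᵐ p ∂(ρ.prod ρ), ‖R p‖ ≤
      (p.1 - 1) ^ 2 * (p.2 - 1) ^ 4 + (p.1 - 1) ^ 4 * (p.2 - 1) ^ 2 := by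
    filter_upwards [hp] with p hp
    have hx : |(p.1 - 1) * (p.2 - 1)| ≤ 1 / 2 := by
      rw [abs_mul]; nlinarith [hp.1, hp.2, abs_nonneg (p.1 - 1), abs_nonneg (p.2 - 1)]
    refine (abs_inv_sqrt_one_sub_sub_le hx).trans ?_
    have h3 : |(p.1 - 1) * (p.2 - 1)| ^ 3 = |(p.1 - 1) * (p.2 - 1)| ^ 2 * (|p.1 - 1| * |p.2 - 1|) := by
      rw [← abs_mul]; ring
    rw [h3, sq_abs]
    -- This trades the third absolute moments of the cubic remainder for even moments.
    have h4 : 2 * (|p.1 - 1| * |p.2 - 1|) ≤ (p.1 - 1) ^ 2 + (p.2 - 1) ^ 2 := by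
      nlinarith [sq_nonneg (|p.1 - 1| - |p.2 - 1|), sq_abs (p.1 - 1), sq_abs (p.2 - 1)]
    nlinarith [mul_le_mul_of_nonneg_left h4 (sq_nonneg ((p.1 - 1) * (p.2 - 1)))]
  have hRm : Measurable R := by rw [hR]; fun_prop
  have hRi : Integrable R (ρ.prod ρ) :=
    ((hpow 2 4).add (hpow 4 2)).mono' hRm.aestronglyMeasurable hRle
  have hRint : |∫ p, R p ∂(ρ.prod ρ)| ≤ 2 * ((∫ v, (v - 1) ^ 2 ∂ρ) * ∫ v, (v - 1) ^ 4 ∂ρ) := by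
    refine (norm_integral_le_of_norm_le ((hpow 2 4).add (hpow 4 2)) hRle).trans (le_of_eq ?_)
    simp only [Pi.add_apply]
    rw [integral_add (hpow 2 4) (hpow 4 2), hint, hint]; ring
  have hG : ∫ p : ℝ × ℝ, (Real.sqrt (1 - (p.1 - 1) * (p.2 - 1)))⁻¹ ∂(ρ.prod ρ) =
      ρ.real Set.univ ^ 2 + 1 / 2 * (∫ v, (v - 1) ∂ρ) ^ 2 + 3 / 8 * (∫ v, (v - 1) ^ 2 ∂ρ) ^ 2 +
        ∫ p, R p ∂(ρ.prod ρ) := by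
    have h0 := hint 0 0
    have h1 := hint 1 1
    have h2 := hint 2 2
    simp only [pow_zero, pow_one, mul_one] at h0 h1
    have k0 : ∫ _ : ℝ × ℝ, (1 : ℝ) ∂(ρ.prod ρ) = ρ.real Set.univ ^ 2 := by
      rw [h0]; simp [sq]
    have e : (fun p : ℝ × ℝ => (Real.sqrt (1 - (p.1 - 1) * (p.2 - 1)))⁻¹) = fun p =>
        1 + 1 / 2 * ((p.1 - 1) * (p.2 - 1)) + 3 / 8 * ((p.1 - 1) ^ 2 * (p.2 - 1) ^ 2) + R p := by
      ext p; rw [hR]; ring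
    have j1 : Integrable (fun p : ℝ × ℝ => (p.1 - 1) * (p.2 - 1)) (ρ.prod ρ) := by
      simpa using hpow 1 1
    have j2 : Integrable (fun p : ℝ × ℝ => 1 + 1 / 2 * ((p.1 - 1) * (p.2 - 1))) (ρ.prod ρ) :=
      (integrable_const 1).add (j1.const_mul _)
    have j3 : Integrable (fun p : ℝ × ℝ => 1 + 1 / 2 * ((p.1 - 1) * (p.2 - 1)) +
        3 / 8 * ((p.1 - 1) ^ 2 * (p.2 - 1) ^ 2)) (ρ.prod ρ) := j2.add ((hpow 2 2).const_mul _)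
    rw [e, integral_add j3 hRi, integral_add j2 ((hpow 2 2).const_mul _),
      integral_add (integrable_const 1) (j1.const_mul _),
      integral_const_mul, integral_const_mul, h1, h2, k0]
    ring
  rw [hexp, integral_add i3 (integrable_const 1),
    integral_sub i2 (i1.const_mul 2), integral_const_mul, e2, e1, hG]
  simp only [integral_const, probReal_univ, smul_eq_mul, mul_one]
  refine le_trans (le_of_eq ?_) hRint
  congr 1; ring

/-- The first-order expansion of the density ratio is integrated in `v`. The first factor of the
bound will be `O(t)`, so that its cube is an admissible error. -/
theorem abs_mixDensity_sub_one_le (hρ : ∀ᵐ v ∂ρ, |v - 1| ≤ 1 / 8) (h1 : ρ.real Set.univ ≤ 1)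
    (u : ℝ) :
    |mixDensity ρ u - 1| ≤ (1 - ρ.real Set.univ + |∫ v, (v - 1) ∂ρ| + ∫ v, (v - 1) ^ 2 ∂ρ) *
      (784 * Real.exp ((1 + u ^ 2) / 7)) := by
  have i0 := integrable_gaussRatio_of_concentrated hρ u
  have i1 : Integrable (fun v : ℝ => v - 1) ρ := by simpa using integrable_sub_one_pow hρ 1
  have i2 := integrable_sub_one_pow hρ 2
  set Q := 2 * (1 + u ^ 2) ^ 2 * Real.exp ((1 + u ^ 2) / 14) with hQ
  have hle : |∫ v, (gaussRatio v u - 1 - (v - 1) * ((u ^ 2 - 1) / 2)) ∂ρ| ≤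
      (∫ v, (v - 1) ^ 2 ∂ρ) * Q := by
    rw [← integral_mul_const, ← Real.norm_eq_abs]
    refine norm_integral_le_of_norm_le (i2.mul_const Q) ?_
    filter_upwards [hρ] with v hv using abs_gaussRatio_sub_le hv u
  have he : ∫ v, (gaussRatio v u - 1 - (v - 1) * ((u ^ 2 - 1) / 2)) ∂ρ =
      mixDensity ρ u - ρ.real Set.univ - (∫ v, (v - 1) ∂ρ) * ((u ^ 2 - 1) / 2) := by
    have i3 : Integrable (fun v => gaussRatio v u - 1) ρ := i0.sub (integrable_const 1)
    rw [integral_sub i3 (i1.mul_const _),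
      integral_sub i0 (integrable_const 1), integral_mul_const]
    simp [mixDensity]
  rw [he] at hle
  -- The polynomial factor is absorbed by doubling the exponential rate; `392 = 2! * 14 ^ 2`.
  have hx : (1 + u ^ 2) ^ 2 ≤ 392 * Real.exp ((1 + u ^ 2) / 14) := by
    have := Real.pow_div_factorial_le_exp (x := (1 + u ^ 2) / 14) (by positivity) 2
    rw [div_le_iff₀ (by positivity)] at this
    norm_num [Nat.factorial] at this
    nlinarith
  have hQle : Q ≤ 784 * Real.exp ((1 + u ^ 2) / 7) := by
    have : Real.exp ((1 + u ^ 2) / 7) =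
        Real.exp ((1 + u ^ 2) / 14) * Real.exp ((1 + u ^ 2) / 14) := by
      rw [← Real.exp_add]; congr 1; ring
    rw [hQ, this]
    nlinarith [mul_le_mul_of_nonneg_right hx (Real.exp_pos ((1 + u ^ 2) / 14)).le]
  have hE : 1 ≤ Real.exp ((1 + u ^ 2) / 14) := Real.one_le_exp (by positivity)
  have hux : (1 + u ^ 2) ≤ (1 + u ^ 2) ^ 2 := by nlinarith [sq_nonneg u]
  have hQ1 : (1 + u ^ 2) ≤ Q := by
    rw [hQ]
    nlinarith [mul_le_mul hux hE (by norm_num) (by positivity), sq_nonneg (1 + u ^ 2)]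
  have hQ2 : |(u ^ 2 - 1) / 2| ≤ Q := by
    rw [abs_le]; constructor <;> nlinarith [sq_nonneg u]
  have hQ3 : 1 ≤ Q := by nlinarith [sq_nonneg u]
  have hm2 : 0 ≤ ∫ v, (v - 1) ^ 2 ∂ρ := integral_nonneg fun v => sq_nonneg _
  have h0 : 0 ≤ 1 - ρ.real Set.univ := by linarith
  calc |mixDensity ρ u - 1|
      = |(mixDensity ρ u - ρ.real Set.univ - (∫ v, (v - 1) ∂ρ) * ((u ^ 2 - 1) / 2)) +
          (∫ v, (v - 1) ∂ρ) * ((u ^ 2 - 1) / 2) + -(1 - ρ.real Set.univ)| := by congr 1; ring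
    _ ≤ (∫ v, (v - 1) ^ 2 ∂ρ) * Q + |∫ v, (v - 1) ∂ρ| * Q + (1 - ρ.real Set.univ) * Q := by
      refine (abs_add_three _ _ _).trans ?_
      rw [abs_mul, abs_neg, abs_of_nonneg h0]
      gcongr
      nlinarith
    _ = (1 - ρ.real Set.univ + |∫ v, (v - 1) ∂ρ| + ∫ v, (v - 1) ^ 2 ∂ρ) * Q := by ring
    _ ≤ _ := by
      gcongr

end Concentrated

/-! ### Truncation of the mixing law and the one-dimensional expansion -/

/-- `ν` is a law on `(0, ∞)` with mean `1` and variance `t`, whose fourth and sixth central moments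
are of the order of `t ^ 2` and `t ^ 3`, with bounds controlled by `M`. -/
structure IsConcentratedMixing (ν : Measure ℝ) (t M : ℝ) : Prop where
  pos : ∀ᵐ v ∂ν, 0 < v
  integrable_inv_sqrt : Integrable (fun v => (Real.sqrt v)⁻¹) ν
  inv_sqrt_le : ∫ v, (Real.sqrt v)⁻¹ ∂ν ≤ M
  integrable_pow : ∀ k : ℕ, Integrable (fun v => (v - 1) ^ k) ν
  mean : ∫ v, (v - 1) ∂ν = 0
  variance : ∫ v, (v - 1) ^ 2 ∂ν = t
  fourth_le : ∫ v, (v - 1) ^ 4 ∂ν ≤ M * t ^ 2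
  sixth_le : ∫ v, (v - 1) ^ 6 ∂ν ≤ M * t ^ 3

/-- The set of values of the mixing variable close to its mean. -/
def nearOne : Set ℝ := {v | |v - 1| ≤ 1 / 8}

theorem measurableSet_nearOne : MeasurableSet nearOne :=
  measurableSet_le (by fun_prop) measurable_const

/-- A Markov-type inequality: tail integrals are controlled by an even central moment. -/
theorem abs_setIntegral_nearOne_compl_le {ν : Measure ℝ} {k : ℕ} (hk : Even k) {K : ℝ}
    (hK : 0 ≤ K) (hi : Integrable (fun v : ℝ => (v - 1) ^ k) ν) {h : ℝ → ℝ}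
    (hle : ∀ v, 1 / 8 < |v - 1| → |h v| ≤ K * (v - 1) ^ k) :
    |∫ v in nearOneᶜ, h v ∂ν| ≤ K * ∫ v, (v - 1) ^ k ∂ν := by
  rw [← integral_const_mul, ← Real.norm_eq_abs]
  refine (norm_integral_le_of_norm_le (hi.const_mul K).restrict (g := fun v => K * (v - 1) ^ k)
    ?_).trans ?_
  · filter_upwards [ae_restrict_mem measurableSet_nearOne.compl] with v hv
    exact hle v (not_le.1 hv)
  · exact setIntegral_le_integral (hi.const_mul K)
      (Filter.Eventually.of_forall fun v => mul_nonneg hK (hk.pow_nonneg _))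

/-- `klFun` is Lipschitz with constant a bound on `|log|`. From below, the part near 1 alone
contributes at least `exp (-u ^ 2 / 2) / 4`; from above, the whole density is at most `M * exp (u ^
2 / 2)`, which is where the moment of order `-1/2` is needed. So `|log|` grows only quadratically in
`u`, and no square of the tail density appears. -/
theorem abs_klFun_mixDensity_sub_nearOne_le {ν : Measure ℝ} [IsFiniteMeasure ν] {M : ℝ}
    (hpos : ∀ᵐ v ∂ν, 0 < v) (hI : Integrable (fun v => (Real.sqrt v)⁻¹) ν)
    (hM : ∫ v, (Real.sqrt v)⁻¹ ∂ν ≤ M) (hA : 1 / 2 ≤ (ν.restrict nearOne).real Set.univ) (u : ℝ) :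
    |klFun (mixDensity ν u) - klFun (mixDensity (ν.restrict nearOne) u)| ≤
      (M + 2) * ((1 + u ^ 2) * mixDensity (ν.restrict nearOneᶜ) u) := by
  have hint := integrable_gaussRatio hpos hI u
  have hadd : mixDensity ν u =
      mixDensity (ν.restrict nearOne) u + mixDensity (ν.restrict nearOneᶜ) u :=
    (integral_add_compl measurableSet_nearOne hint).symm
  set a := mixDensity (ν.restrict nearOne) u
  set d := mixDensity (ν.restrict nearOneᶜ) u
  have hd : 0 ≤ d := mixDensity_nonneg _ _
  have ha : 1 / 4 * Real.exp (-(u ^ 2 / 2)) ≤ a := by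
    have h1 : ∫ _, 1 / 2 * Real.exp (-(u ^ 2 / 2)) ∂(ν.restrict nearOne) ≤ a := by
      refine integral_mono_ae (integrable_const _) hint.restrict ?_
      filter_upwards [ae_restrict_mem measurableSet_nearOne] with v hv
      exact half_exp_le_gaussRatio hv u
    rw [integral_const, smul_eq_mul] at h1
    refine le_trans ?_ h1
    nlinarith [mul_le_mul_of_nonneg_right hA (Real.exp_pos (-(u ^ 2 / 2))).le]
  have ha0 : 0 < a := lt_of_lt_of_le (by positivity) ha
  have hle : a + d ≤ M * Real.exp (u ^ 2 / 2) := by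
    rw [← hadd]
    exact (mixDensity_le hpos hI u).trans (by gcongr)
  have hM0 : 0 < M := by
    by_contra hM0
    nlinarith [Real.exp_pos (u ^ 2 / 2), mul_nonneg (sub_nonneg.2 (not_lt.1 hM0))
      (Real.exp_pos (u ^ 2 / 2)).le]
  have l1 : -2 - u ^ 2 / 2 ≤ Real.log a := by
    refine le_trans ?_ (Real.log_le_log (by positivity) ha)
    rw [Real.log_mul (by norm_num) (by positivity), Real.log_exp]
    have := Real.one_sub_inv_le_log_of_pos (x := 1 / 2) (by norm_num)
    have h4 : Real.log (1 / 4) = Real.log (1 / 2) + Real.log (1 / 2) := by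
      rw [← Real.log_mul (by norm_num) (by norm_num)]; norm_num
    rw [h4]; norm_num at this ⊢; linarith
  have l2 : Real.log a ≤ Real.log (a + d) := Real.log_le_log ha0 (by linarith)
  have l3 : Real.log (a + d) ≤ M + u ^ 2 / 2 := by
    refine (Real.log_le_log (by linarith) hle).trans ?_
    rw [Real.log_mul hM0.ne' (by positivity), Real.log_exp]
    linarith [Real.log_le_sub_one_of_pos hM0]
  have hB : ∀ x, -2 - u ^ 2 / 2 ≤ x → x ≤ M + u ^ 2 / 2 → |x| ≤ (M + 2) * (1 + u ^ 2) := by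
    intro x h1 h2
    rw [abs_le]
    constructor <;> nlinarith [mul_nonneg hM0.le (sq_nonneg u), sq_nonneg u]
  rw [hadd, ← mul_assoc]
  exact abs_klFun_add_sub_klFun_le ha0 hd (hB _ l1 (l2.trans l3)) (hB _ (l1.trans l2) l3)

theorem abs_integral_klFun_sub_le {ρ : Measure ℝ} [IsFiniteMeasure ρ]
    (hρ : ∀ᵐ v ∂ρ, |v - 1| ≤ 1 / 8) (h1 : ρ.real Set.univ ≤ 1) :
    Integrable (fun u => klFun (mixDensity ρ u)) (gaussianReal 0 1) ∧
    |∫ u, klFun (mixDensity ρ u) ∂(gaussianReal 0 1) -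
        1 / 2 * ∫ u, (mixDensity ρ u - 1) ^ 2 ∂(gaussianReal 0 1)| ≤
      (1 - ρ.real Set.univ + |∫ v, (v - 1) ∂ρ| + ∫ v, (v - 1) ^ 2 ∂ρ) ^ 3 *
        (4 * 784 ^ 3 * Real.exp (3 / 7) *
          ∫ u, Real.exp (3 / 7 * u ^ 2) ∂(gaussianReal 0 1)) := by
  set L := 1 - ρ.real Set.univ + |∫ v, (v - 1) ∂ρ| + ∫ v, (v - 1) ^ 2 ∂ρ with hL
  obtain ⟨isq, -⟩ := abs_integral_mixDensity_sub_one_sq_sub_le hρ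
  -- The cube of `exp ((1 + u ^ 2) / 7)` has rate `3/7`, just below the threshold `1/2` of Gaussian
  -- integrability.
  have iexp := integrable_exp_mul_sq_gaussianReal (by norm_num : (3 / 7 : ℝ) < 1 / 2)
  have hb : ∀ u, ‖klFun (mixDensity ρ u) - 1 / 2 * (mixDensity ρ u - 1) ^ 2‖ ≤
      L ^ 3 * (4 * 784 ^ 3 * Real.exp (3 / 7)) * Real.exp (3 / 7 * u ^ 2) := by
    intro u
    have e1 := abs_klFun_sub_le (mixDensity_nonneg ρ u)
    have e2 := pow_le_pow_left₀ (abs_nonneg _) (abs_mixDensity_sub_one_le hρ h1 u) 3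
    have e3 : Real.exp ((1 + u ^ 2) / 7) ^ 3 = Real.exp (3 / 7) * Real.exp (3 / 7 * u ^ 2) := by
      rw [← Real.exp_nat_mul, ← Real.exp_add]; congr 1; push_cast; ring
    rw [← hL, mul_pow, mul_pow, e3] at e2
    rw [Real.norm_eq_abs, one_div_mul_eq_div]
    linarith
  have ib : Integrable (fun u => L ^ 3 * (4 * 784 ^ 3 * Real.exp (3 / 7)) *
      Real.exp (3 / 7 * u ^ 2)) (gaussianReal 0 1) := iexp.const_mul _
  have hm : Measurable fun u => klFun (mixDensity ρ u) - 1 / 2 * (mixDensity ρ u - 1) ^ 2 :=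
    (InformationTheory.measurable_klFun.comp (measurable_mixDensity ρ)).sub
      ((((measurable_mixDensity ρ).sub_const 1).pow_const 2).const_mul _)
  have idiff := ib.mono' hm.aestronglyMeasurable (Filter.Eventually.of_forall hb)
  have ik : Integrable (fun u => klFun (mixDensity ρ u)) (gaussianReal 0 1) :=
    (idiff.add (isq.const_mul (1 / 2))).congr (Filter.Eventually.of_forall fun u => by simp)
  refine ⟨ik, ?_⟩
  rw [← integral_const_mul, ← integral_sub ik (isq.const_mul _), ← Real.norm_eq_abs]
  refine (norm_integral_le_of_norm_le ib (Filter.Eventually.of_forall hb)).trans (le_of_eq ?_)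
  rw [integral_const_mul]; ring

/-- Four errors of order `t ^ 3` add up: discarding the tail, the cubic remainder of `klFun`, the
remainder of the inverse square root, and the change of the low moments under truncation. The
constants depend on `M` only, uniformly over the mixing laws. -/
theorem exists_klDiv_bind_gaussianReal_bound (M : ℝ) (hM : 0 < M) :
    ∃ C t₀ : ℝ, 0 < t₀ ∧ ∀ (ν : Measure ℝ) [IsProbabilityMeasure ν] (t : ℝ), 0 < t → t ≤ t₀ →
      IsConcentratedMixing ν t M →
        klDiv (ν.bind fun v => gaussianReal 0 v.toNNReal) (gaussianReal 0 1) ≠ ⊤ ∧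
        |(klDiv (ν.bind fun v => gaussianReal 0 v.toNNReal) (gaussianReal 0 1)).toReal -
          3 / 16 * t ^ 2| ≤ C * t ^ 3 := by
  set K := 4 * 784 ^ 3 * Real.exp (3 / 7) *
    ∫ u, Real.exp (3 / 7 * u ^ 2) ∂(gaussianReal 0 1) with hK
  have hK0 : 0 ≤ K := by
    have : 0 ≤ ∫ u, Real.exp (3 / 7 * u ^ 2) ∂(gaussianReal 0 1) :=
      integral_nonneg fun u => (Real.exp_pos _).le
    positivity
  refine ⟨(M + 2) * (557056 * M) + (4608 * M + 1) ^ 3 * K + M +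
    (1 / 2 * (4096 * M) ^ 2 + 1 / 4 * (512 * M) ^ 2 + 24 * M), 1 / (8192 * (M + 1)),
    by positivity, ?_⟩
  intro ν _ t ht htt hν
  rw [le_div_iff₀ (by positivity)] at htt
  have ht1 : t ≤ 1 := by nlinarith
  set ρ := ν.restrict nearOne with hρdef
  set τ := ν.restrict nearOneᶜ with hτdef
  have hρ : ∀ᵐ v ∂ρ, |v - 1| ≤ 1 / 8 := ae_restrict_mem measurableSet_nearOne
  have i1 : Integrable (fun v : ℝ => v - 1) ν := by simpa using hν.integrable_pow 1
  have f4 := hν.fourth_le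
  -- contributions of the values far from the mean
  have c0 : 1 - ρ.real Set.univ = ∫ v in nearOneᶜ, (1 : ℝ) ∂ν := by
    rw [hρdef]
    simp [probReal_compl_eq_one_sub measurableSet_nearOne]
  have d0 : |1 - ρ.real Set.univ| ≤ 4096 * M * t ^ 2 := by
    rw [c0]
    -- Off the truncation set `1 < 8 * |v - 1|`, so raising a power of `|v - 1|` by `j` costs `8 ^
    -- j`: here `8 ^ 4`, and below `8 ^ 3` and `8 ^ 2`.
    refine (abs_setIntegral_nearOne_compl_le (k := 4) (K := 4096) (by decide) (by norm_num)
      (hν.integrable_pow 4) fun v hv => ?_).trans (by linarith)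
    have := pow_le_pow_left₀ (by norm_num) hv.le 4
    rw [Even.pow_abs (by decide)] at this
    rw [abs_one]; linarith
  have d1 : |∫ v, (v - 1) ∂ρ| ≤ 512 * M * t ^ 2 := by
    have : ∫ v, (v - 1) ∂ρ = -∫ v in nearOneᶜ, (v - 1) ∂ν := by
      have := integral_add_compl measurableSet_nearOne i1
      rw [hν.mean] at this; linarith
    rw [this, abs_neg]
    refine (abs_setIntegral_nearOne_compl_le (k := 4) (K := 512) (by decide) (by norm_num)
      (hν.integrable_pow 4) fun v hv => ?_).trans (by linarith)
    have h3 := pow_le_pow_left₀ (by norm_num) hv.le 3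
    rw [← Even.pow_abs (by decide : Even 4) (v - 1)]
    nlinarith [abs_nonneg (v - 1), mul_le_mul_of_nonneg_right h3 (abs_nonneg (v - 1))]
  have e2 : ∫ v, (v - 1) ^ 2 ∂ρ = t - ∫ v in nearOneᶜ, (v - 1) ^ 2 ∂ν := by
    have := integral_add_compl measurableSet_nearOne (hν.integrable_pow 2)
    rw [hν.variance] at this; linarith
  have d2 : ∫ v in nearOneᶜ, (v - 1) ^ 2 ∂ν ≤ 64 * M * t ^ 2 := by
    refine (le_abs_self _).trans ((abs_setIntegral_nearOne_compl_le (k := 4) (K := 64) (by decide)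
      (by norm_num) (hν.integrable_pow 4) fun v hv => ?_).trans (by linarith))
    have h2 := pow_le_pow_left₀ (by norm_num) hv.le 2
    rw [sq_abs] at h2
    rw [abs_of_nonneg (sq_nonneg _)]
    nlinarith [sq_nonneg (v - 1), mul_le_mul_of_nonneg_right h2 (sq_nonneg (v - 1))]
  have d2' : 0 ≤ ∫ v in nearOneᶜ, (v - 1) ^ 2 ∂ν := integral_nonneg fun v => sq_nonneg _
  have m2 : 0 ≤ ∫ v, (v - 1) ^ 2 ∂ρ := integral_nonneg fun v => sq_nonneg _
  have m4 : ∫ v, (v - 1) ^ 4 ∂ρ ≤ M * t ^ 2 :=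
    (setIntegral_le_integral (hν.integrable_pow 4)
      (Filter.Eventually.of_forall fun v => (by decide : Even 4).pow_nonneg _)).trans f4
  have m4' : 0 ≤ ∫ v, (v - 1) ^ 4 ∂ρ := integral_nonneg fun v => (by decide : Even 4).pow_nonneg _
  have d6 : ∫ v, (1 + v) ∂τ ≤ 557056 * M * t ^ 3 := by
    -- The constant is `17 * 8 ^ 5`, as `|1 + v| ≤ 17 * |v - 1|` in the tail. The sixth moment is
    -- needed because this term must be `O(t ^ 3)`; the fourth would give only `O(t ^ 2)`.
    refine (le_abs_self _).trans ((abs_setIntegral_nearOne_compl_le (k := 6) (K := 557056)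
      (by decide) (by norm_num) (hν.integrable_pow 6) fun v hv => ?_).trans
      (by linarith [hν.sixth_le]))
    have h5 := pow_le_pow_left₀ (by norm_num) hv.le 5
    have h6 : |1 + v| ≤ 17 * |v - 1| := by
      have : 1 + v = 2 + (v - 1) := by ring
      rw [this]
      refine (abs_add_le _ _).trans ?_
      rw [abs_two]; linarith
    rw [← Even.pow_abs (by decide : Even 6) (v - 1)]
    nlinarith [abs_nonneg (v - 1), mul_le_mul_of_nonneg_right h5 (abs_nonneg (v - 1))]
  have hmass : ρ.real Set.univ ≤ 1 := by
    rw [hρdef, measureReal_restrict_apply MeasurableSet.univ]; exact measureReal_le_one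
  have hhalf : 1 / 2 ≤ ρ.real Set.univ := by
    have := (abs_le.1 d0).2
    have : 4096 * M * t ^ 2 ≤ 1 / 2 := by nlinarith [mul_pos hM ht]
    linarith
  -- Kullback-Leibler divergence of the two parts
  obtain ⟨ikρ, hkρ⟩ := abs_integral_klFun_sub_le hρ hmass
  have h1v : Integrable (fun v : ℝ => 1 + v) τ := by
    refine Integrable.restrict (((integrable_const (2 : ℝ)).add i1).congr
      (Filter.Eventually.of_forall fun v => ?_))
    simp only [Pi.add_apply]; ring
  obtain ⟨iτ, eτ⟩ := integral_one_add_sq_mul_mixDensity (ae_restrict_of_ae hν.pos) h1v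
  have hdiff := abs_klFun_mixDensity_sub_nearOne_le hν.pos hν.integrable_inv_sqrt
    hν.inv_sqrt_le hhalf
  have iτ' : Integrable (fun u => (M + 2) * ((1 + u ^ 2) * mixDensity τ u)) (gaussianReal 0 1) :=
    iτ.const_mul _
  have hmeas : ∀ μ : Measure ℝ, SFinite μ → Measurable fun u => klFun (mixDensity μ u) :=
    fun μ _ => InformationTheory.measurable_klFun.comp (measurable_mixDensity μ)
  have idiff : Integrable (fun u => klFun (mixDensity ν u) - klFun (mixDensity ρ u))
      (gaussianReal 0 1) :=
    iτ'.mono' ((hmeas ν inferInstance).sub (hmeas ρ inferInstance)).aestronglyMeasurable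
      (Filter.Eventually.of_forall hdiff)
  have ikν : Integrable (fun u => klFun (mixDensity ν u)) (gaussianReal 0 1) :=
    (idiff.add ikρ).congr (Filter.Eventually.of_forall fun u => by simp)
  obtain ⟨hne, heq⟩ := klDiv_bind_gaussianReal hν.pos hν.integrable_inv_sqrt ikν
  refine ⟨hne, ?_⟩
  rw [heq]
  have s1 : |∫ u, klFun (mixDensity ν u) ∂(gaussianReal 0 1) -
      ∫ u, klFun (mixDensity ρ u) ∂(gaussianReal 0 1)| ≤ (M + 2) * (557056 * M) * t ^ 3 := by
    rw [← integral_sub ikν ikρ, ← Real.norm_eq_abs]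
    refine (norm_integral_le_of_norm_le iτ' (Filter.Eventually.of_forall hdiff)).trans ?_
    rw [integral_const_mul, eτ]
    nlinarith
  have s2 : (1 - ρ.real Set.univ + |∫ v, (v - 1) ∂ρ| + ∫ v, (v - 1) ^ 2 ∂ρ) ^ 3 * K ≤
      (4608 * M + 1) ^ 3 * K * t ^ 3 := by
    have : 1 - ρ.real Set.univ + |∫ v, (v - 1) ∂ρ| + ∫ v, (v - 1) ^ 2 ∂ρ ≤
        (4608 * M + 1) * t := by
      have := (abs_le.1 d0).2
      nlinarith [mul_le_mul_of_nonneg_left ht1 (mul_pos hM ht).le]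
    have h0 : 0 ≤ 1 - ρ.real Set.univ + |∫ v, (v - 1) ∂ρ| + ∫ v, (v - 1) ^ 2 ∂ρ := by
      have := abs_nonneg (∫ v, (v - 1) ∂ρ); linarith
    have := mul_le_mul_of_nonneg_right (pow_le_pow_left₀ h0 this 3) hK0
    rw [mul_pow] at this; linarith
  have s3 := (abs_integral_mixDensity_sub_one_sq_sub_le hρ).2
  have s4 : (∫ v, (v - 1) ^ 2 ∂ρ) * ∫ v, (v - 1) ^ 4 ∂ρ ≤ M * t ^ 3 := by
    have : ∫ v, (v - 1) ^ 2 ∂ρ ≤ t := by linarith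
    calc _ ≤ t * (M * t ^ 2) := mul_le_mul this m4 m4' ht.le
      _ = _ := by ring
  have ht4 : t ^ 4 ≤ t ^ 3 := pow_le_pow_of_le_one ht.le ht1 (by norm_num)
  have q0 : (1 - ρ.real Set.univ) ^ 2 ≤ (4096 * M) ^ 2 * t ^ 3 := by
    rw [← sq_abs]
    calc _ ≤ (4096 * M * t ^ 2) ^ 2 := pow_le_pow_left₀ (abs_nonneg _) d0 2
      _ = (4096 * M) ^ 2 * t ^ 4 := by ring
      _ ≤ _ := by gcongr
  have q1 : (∫ v, (v - 1) ∂ρ) ^ 2 ≤ (512 * M) ^ 2 * t ^ 3 := by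
    rw [← sq_abs]
    calc _ ≤ (512 * M * t ^ 2) ^ 2 := pow_le_pow_left₀ (abs_nonneg _) d1 2
      _ = (512 * M) ^ 2 * t ^ 4 := by ring
      _ ≤ _ := by gcongr
  have q2 : |(∫ v, (v - 1) ^ 2 ∂ρ) ^ 2 - t ^ 2| ≤ 128 * M * t ^ 3 := by
    have hp := mul_le_mul d2 (by linarith : t + ∫ v, (v - 1) ^ 2 ∂ρ ≤ 2 * t) (by linarith)
      (by positivity)
    have hn := mul_nonneg d2' (by linarith : 0 ≤ t + ∫ v, (v - 1) ^ 2 ∂ρ)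
    have e : (∫ v, (v - 1) ^ 2 ∂ρ) ^ 2 - t ^ 2 =
        -((∫ v in nearOneᶜ, (v - 1) ^ 2 ∂ν) * (t + ∫ v, (v - 1) ^ 2 ∂ρ)) := by rw [e2]; ring
    rw [e, abs_neg, abs_of_nonneg hn]
    linarith
  have q0' := sq_nonneg (1 - ρ.real Set.univ)
  have q1' := sq_nonneg (∫ v, (v - 1) ∂ρ)
  rw [abs_le] at s1 hkρ s3 q2 ⊢
  have := hkρ.1; have := hkρ.2; have := s3.1; have := s3.2; have := q2.1; have := q2.2
  have := s1.1; have := s1.2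
  constructor <;> linarith

/-! ### Moments from the moment generating function -/

/-- Here `ψ` is the cumulant generating function of `v - 1`: its first two derivatives at 0 give
mean and variance, and the sub-Gaussian bound `2 * t * a ^ 2` gives the scaling of the higher
moments. The constant 11000 covers the sixth moment, `6! * 2 * 7.5 = 10800`, and the inverse square
root, `1 + 10000`. -/
theorem isConcentratedMixing_of_mgf {ν : Measure ℝ} [IsProbabilityMeasure ν] {t : ℝ} (ht : 0 < t)
    (ht16 : t ≤ 1 / 16) (hpos : ∀ᵐ v ∂ν, 0 < v) (hinv : Integrable (fun v => v⁻¹) ν)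
    (hinv_le : ∫ v, v⁻¹ ∂ν ≤ 10000) {ψ ψ' : ℝ → ℝ}
    (hmgf : ∀ a, |a * t| ≤ 1 / 4 → Integrable (fun v => Real.exp (a * (v - 1))) ν ∧
      ∫ v, Real.exp (a * (v - 1)) ∂ν = Real.exp (ψ a))
    (hle : ∀ a, |a * t| ≤ 1 / 4 → ψ a ≤ 2 * t * a ^ 2) (hψ0 : ψ 0 = 0)
    (hψ : ∀ a, |a * t| < 1 / 4 → HasDerivAt ψ (ψ' a) a) (hψ'0 : ψ' 0 = 0)
    (hψ' : HasDerivAt ψ' t 0) : IsConcentratedMixing ν t 11000 := by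
  have hI : Integrable (fun v => (Real.sqrt v)⁻¹) ν ∧ ∫ v, (Real.sqrt v)⁻¹ ∂ν ≤ 11000 := by
    have hb : ∀ᵐ v ∂ν, (Real.sqrt v)⁻¹ ≤ 1 + v⁻¹ := by
      filter_upwards [hpos] with v hv
      rw [← Real.sqrt_inv]
      have : 0 < v⁻¹ := inv_pos.2 hv
      rw [Real.sqrt_le_left (by linarith)]; nlinarith
    have hi : Integrable (fun v : ℝ => 1 + v⁻¹) ν := (integrable_const 1).add hinv
    have h1 : Integrable (fun v => (Real.sqrt v)⁻¹) ν := by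
      refine hi.mono' (by fun_prop) ?_
      filter_upwards [hb] with v hv
      rwa [Real.norm_of_nonneg (by positivity)]
    refine ⟨h1, (integral_mono_ae h1 hi hb).trans ?_⟩
    rw [integral_add (integrable_const 1) hinv]
    simp; linarith
  have hnhds : ∀ᶠ a in nhds (0 : ℝ), |a * t| < 1 / 4 := by
    have : Filter.Tendsto (fun a : ℝ => |a * t|) (nhds 0) (nhds |0 * t|) :=
      (by fun_prop : Continuous fun a : ℝ => |a * t|).tendsto 0
    exact this.eventually_lt_const (by simp)
  set X : ℝ → ℝ := fun v => v - 1 with hX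
  have hset : (0 : ℝ) ∈ interior (integrableExpSet X ν) := by
    rw [mem_interior_iff_mem_nhds]
    filter_upwards [hnhds] with a ha using (hmgf a ha.le).1
  have hmgfeq : ∀ a, |a * t| < 1 / 4 → mgf X ν a = Real.exp (ψ a) := fun a ha => (hmgf a ha.le).2
  have hnear : ∀ a, |a * t| < 1 / 4 → mgf X ν =ᶠ[nhds a] fun a => Real.exp (ψ a) := by
    intro a ha
    have : Filter.Tendsto (fun a : ℝ => |a * t|) (nhds a) (nhds |a * t|) :=
      (by fun_prop : Continuous fun a : ℝ => |a * t|).tendsto a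
    filter_upwards [this.eventually_lt_const ha] with b hb using hmgfeq b hb
  have hd1 : ∀ a, |a * t| < 1 / 4 → HasDerivAt (mgf X ν) (Real.exp (ψ a) * ψ' a) a :=
    fun a ha => ((hψ a ha).exp).congr_of_eventuallyEq (hnear a ha)
  have h0 : |(0 : ℝ) * t| < 1 / 4 := by simp
  have hmean : ∫ v, X v ∂ν = 0 := by
    rw [← deriv_mgf_zero hset, (hd1 0 h0).deriv, hψ'0, mul_zero]
  have hvar : ∫ v, X v ^ 2 ∂ν = t := by
    have h2 := iteratedDeriv_mgf_zero hset 2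
    rw [iteratedDeriv_succ, iteratedDeriv_one] at h2
    have e : deriv (mgf X ν) =ᶠ[nhds 0] fun a => Real.exp (ψ a) * ψ' a := by
      filter_upwards [hnhds] with a ha using (hd1 a ha).deriv
    have := (((hψ 0 h0).exp).mul hψ').congr_of_eventuallyEq e
    rw [this.deriv, hψ0, hψ'0] at h2
    simp at h2
    exact h2.symm
  -- even central moments are controlled by the moment generating function at `± 1 / √t`
  have heven : ∀ k : ℕ, ∫ v, X v ^ (2 * k) ∂ν ≤
      (2 * k).factorial * t ^ k * (2 * Real.exp 2) := by
    intro k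
    set q := (Real.sqrt t)⁻¹ with hq
    have hst : 0 < Real.sqrt t := Real.sqrt_pos.2 ht
    have hq0 : 0 < q := inv_pos.2 hst
    have hqt : q * t = Real.sqrt t := by
      rw [hq]; nth_rewrite 2 [← Real.mul_self_sqrt ht.le]; field_simp
    have hq2 : t * q ^ 2 = 1 := by
      rw [hq, inv_pow, Real.sq_sqrt ht.le]; field_simp
    -- The hypothesis `t ≤ 1/16` is exactly what puts `± 1 / √t` in the admissible range; there `ψ`
    -- is at most `2`.
    have hs4 : Real.sqrt t ≤ 1 / 4 := by
      rw [Real.sqrt_le_left (by norm_num)]; linarith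
    have hp : |q * t| ≤ 1 / 4 := by rw [hqt, abs_of_pos hst]; exact hs4
    have hn : |-q * t| ≤ 1 / 4 := by rw [neg_mul, abs_neg]; exact hp
    obtain ⟨ip, ep⟩ := hmgf q hp
    obtain ⟨im, em⟩ := hmgf (-q) hn
    have lp : Real.exp (ψ q) ≤ Real.exp 2 := Real.exp_le_exp.2 ((hle q hp).trans (by linarith))
    have lm : Real.exp (ψ (-q)) ≤ Real.exp 2 :=
      Real.exp_le_exp.2 ((hle (-q) hn).trans (by rw [neg_sq]; linarith))
    have hb : ∀ v, X v ^ (2 * k) ≤ (2 * k).factorial * t ^ k *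
        (Real.exp (q * (v - 1)) + Real.exp (-q * (v - 1))) := by
      intro v
      have h1 := Real.pow_div_factorial_le_exp (x := |q * X v|) (abs_nonneg _) (2 * k)
      rw [div_le_iff₀ (by positivity), Even.pow_abs (by simp), mul_pow] at h1
      have h2 : Real.exp |q * X v| ≤ Real.exp (q * (v - 1)) + Real.exp (-q * (v - 1)) := by
        rcases abs_cases (q * X v) with ⟨h, _⟩ | ⟨h, _⟩ <;> rw [h]
        · exact le_add_of_nonneg_right (Real.exp_pos _).le
        · rw [← neg_mul]; exact le_add_of_nonneg_left (Real.exp_pos _).le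
      have h3 : t ^ k * q ^ (2 * k) = 1 := by rw [pow_mul, ← mul_pow, hq2, one_pow]
      calc X v ^ (2 * k) = t ^ k * (q ^ (2 * k) * X v ^ (2 * k)) := by rw [← mul_assoc, h3, one_mul]
        _ ≤ t ^ k * (Real.exp |q * X v| * (2 * k).factorial) := by gcongr
        _ ≤ t ^ k * ((Real.exp (q * (v - 1)) + Real.exp (-q * (v - 1))) * (2 * k).factorial) := by
          gcongr
        _ = _ := by ring
    refine (integral_mono (integrable_pow_of_mem_interior_integrableExpSet hset _)
      ((ip.add im).const_mul _) hb).trans ?_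
    rw [integral_const_mul]
    simp only [Pi.add_apply]
    rw [integral_add ip im, ep, em]
    gcongr
    linarith
  have he2 : Real.exp 2 ≤ 7.5 := by
    have : Real.exp 2 = Real.exp 1 * Real.exp 1 := by rw [← Real.exp_add]; norm_num
    rw [this]; nlinarith [Real.exp_one_lt_d9, Real.exp_pos 1]
  refine ⟨hpos, hI.1, hI.2, fun k => integrable_pow_of_mem_interior_integrableExpSet hset k,
    hmean, hvar, ?_, ?_⟩
  · refine (heven 2).trans ?_
    norm_num [Nat.factorial]; nlinarith [pow_pos ht 2]
  · refine (heven 3).trans ?_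
    norm_num [Nat.factorial]; nlinarith [pow_pos ht 3]

/-- Change of measure: if weighting a density by `g` gives `C` times another probability density,
the expectation of `g` is `C`. All the exact expectations of the two mixing laws are read off this
way. -/
theorem integral_withDensity_of_mul_eq {p q g : ℝ → ℝ} {C : ℝ} (hp : Measurable p)
    (hq : Measurable q) (hq0 : ∀ v, 0 ≤ q v) (hp0 : ∀ v, 0 ≤ p v)
    (hq1 : ∫⁻ v, ENNReal.ofReal (q v) = 1) (h : ∀ᵐ v, p v * g v = C * q v) :
    Integrable g (volume.withDensity fun v => ENNReal.ofReal (p v)) ∧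
      ∫ v, g v ∂(volume.withDensity fun v => ENNReal.ofReal (p v)) = C := by
  have hqi : Integrable q := by
    refine ⟨hq.aestronglyMeasurable, ?_⟩
    rw [hasFiniteIntegral_iff_ofReal (Filter.Eventually.of_forall hq0), hq1]
    exact ENNReal.one_lt_top
  have hqe : ∫ v, q v = 1 := by
    rw [integral_eq_lintegral_of_nonneg_ae (Filter.Eventually.of_forall hq0)
      hq.aestronglyMeasurable, hq1, ENNReal.toReal_one]
  rw [integrable_withDensity_iff hp.ennreal_ofReal
    (Filter.Eventually.of_forall fun _ => ENNReal.ofReal_lt_top),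
    integral_withDensity_eq_integral_toReal_smul hp.ennreal_ofReal
    (Filter.Eventually.of_forall fun _ => ENNReal.ofReal_lt_top)]
  simp only [ENNReal.toReal_ofReal (hp0 _), smul_eq_mul]
  refine ⟨(hqi.const_mul C).congr ?_, ?_⟩
  · filter_upwards [h] with v hv
    rw [← hv, mul_comm]
  · rw [integral_congr_ae h, integral_const_mul, hqe, mul_one]

/-! ### Normalization of the inverse Gaussian density -/

open Filter in
theorem tendsto_intervalIntegral_exp_neg_sq_atTop :
    Tendsto (fun x : ℝ => ∫ y in (0 : ℝ)..x, Real.exp (-y ^ 2)) atTop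
      (nhds (Real.sqrt Real.pi / 2)) := by
  have h1 : IntegrableOn (fun y : ℝ => Real.exp (-y ^ 2)) (Set.Ioi 0) := by
    simpa using (integrable_exp_neg_mul_sq (b := 1) one_pos).integrableOn
  have := intervalIntegral_tendsto_integral_Ioi 0 h1 tendsto_id
  have h2 := integral_gaussian_Ioi 1
  simp only [neg_mul, one_mul, div_one] at h2
  rwa [h2] at this

open Filter in
theorem tendsto_intervalIntegral_exp_neg_sq_atBot :
    Tendsto (fun x : ℝ => ∫ y in (0 : ℝ)..x, Real.exp (-y ^ 2)) atBot
      (nhds (-(Real.sqrt Real.pi / 2))) := by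
  have h := (tendsto_intervalIntegral_exp_neg_sq_atTop.comp tendsto_neg_atBot_atTop).neg
  refine h.congr fun x => ?_
  have := intervalIntegral.integral_comp_neg (a := x) (b := 0)
    (fun y : ℝ => Real.exp (-y ^ 2))
  simp only [neg_zero, neg_sq] at this
  rw [Function.comp_apply, ← this, intervalIntegral.integral_symm]
  simp

theorem hasDerivAt_intervalIntegral_exp_neg_sq (x : ℝ) :
    HasDerivAt (fun x : ℝ => ∫ y in (0 : ℝ)..x, Real.exp (-y ^ 2)) (Real.exp (-x ^ 2)) x := by
  have hc : Continuous fun y : ℝ => Real.exp (-y ^ 2) := by fun_prop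
  exact intervalIntegral.integral_hasDerivAt_right (hc.intervalIntegrable _ _)
    hc.stronglyMeasurable.stronglyMeasurableAtFilter hc.continuousAt

-- An explicit antiderivative in `s = √v`, with `E` an unnormalized error function: `E (b * s - a /
-- s) + exp (4 * a * b) * E (-(b * s + a / s))`. The second summand cancels the unwanted part of the
-- derivative of the first and contributes equally at both ends, leaving `√π`.
open Filter in
theorem integral_Ioi_invGaussian_kernel {a b : ℝ} (ha : 0 < a) (hb : 0 < b) :
    IntegrableOn (fun v : ℝ => a / (v * Real.sqrt v) *
        Real.exp (-(b * Real.sqrt v - a / Real.sqrt v) ^ 2)) (Set.Ioi 0) ∧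
      ∫ v in Set.Ioi (0 : ℝ), a / (v * Real.sqrt v) *
        Real.exp (-(b * Real.sqrt v - a / Real.sqrt v) ^ 2) = Real.sqrt Real.pi := by
  set E : ℝ → ℝ := fun x => ∫ y in (0 : ℝ)..x, Real.exp (-y ^ 2) with hE
  set G : ℝ → ℝ := fun s => E (b * s - a * s⁻¹) + Real.exp (4 * a * b) * E (-(b * s + a * s⁻¹))
    with hG
  set l₀ : ℝ := -(Real.sqrt Real.pi / 2) + Real.exp (4 * a * b) * -(Real.sqrt Real.pi / 2) with hl
  -- The limit is assigned as value at 0, since the improper fundamental theorem requires continuity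
  -- at the endpoint.
  set F : ℝ → ℝ := fun v => if v ≤ 0 then l₀ else G (Real.sqrt v) with hF
  have hsqrt0 : Tendsto Real.sqrt (nhdsWithin 0 (Set.Ioi 0)) (nhdsWithin 0 (Set.Ioi 0)) := by
    refine tendsto_nhdsWithin_iff.2 ⟨?_, ?_⟩
    · have := (Real.continuous_sqrt.tendsto 0).mono_left (nhdsWithin_le_nhds (s := Set.Ioi 0))
      simpa using this
    · filter_upwards [self_mem_nhdsWithin] with v hv using Real.sqrt_pos.2 hv
  have hid0 : Tendsto (fun s : ℝ => b * s) (nhdsWithin 0 (Set.Ioi 0)) (nhds 0) := by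
    have : Tendsto (fun s : ℝ => b * s) (nhds 0) (nhds (b * 0)) :=
      (continuous_const.mul continuous_id).tendsto 0
    rw [mul_zero] at this
    exact this.mono_left nhdsWithin_le_nhds
  have hinv0 : Tendsto (fun s : ℝ => a * s⁻¹) (nhdsWithin 0 (Set.Ioi 0)) atTop :=
    tendsto_inv_nhdsGT_zero.const_mul_atTop ha
  have hG0 : Tendsto G (nhdsWithin 0 (Set.Ioi 0)) (nhds l₀) := by
    have h1 : Tendsto (fun s : ℝ => b * s - a * s⁻¹) (nhdsWithin 0 (Set.Ioi 0)) atBot := by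
      simp only [sub_eq_add_neg]
      exact hid0.add_atBot (tendsto_neg_atTop_atBot.comp hinv0)
    have h2 : Tendsto (fun s : ℝ => -(b * s + a * s⁻¹)) (nhdsWithin 0 (Set.Ioi 0)) atBot :=
      tendsto_neg_atTop_atBot.comp (hid0.add_atTop hinv0)
    exact (tendsto_intervalIntegral_exp_neg_sq_atBot.comp h1).add
      ((tendsto_intervalIntegral_exp_neg_sq_atBot.comp h2).const_mul _)
  have hGtop : Tendsto G atTop
      (nhds (Real.sqrt Real.pi / 2 + Real.exp (4 * a * b) * -(Real.sqrt Real.pi / 2))) := by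
    have hi : Tendsto (fun s : ℝ => a * s⁻¹) atTop (nhds 0) := by
      simpa using (tendsto_inv_atTop_zero (𝕜 := ℝ)).const_mul a
    have hbs : Tendsto (fun s : ℝ => b * s) atTop atTop := tendsto_id.const_mul_atTop hb
    have h1 : Tendsto (fun s : ℝ => b * s - a * s⁻¹) atTop atTop := by
      simp only [sub_eq_add_neg]
      exact hbs.atTop_add hi.neg
    have h2 : Tendsto (fun s : ℝ => -(b * s + a * s⁻¹)) atTop atBot :=
      tendsto_neg_atTop_atBot.comp (hbs.atTop_add hi)
    exact (tendsto_intervalIntegral_exp_neg_sq_atTop.comp h1).add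
      ((tendsto_intervalIntegral_exp_neg_sq_atBot.comp h2).const_mul _)
  have hFcont : ContinuousWithinAt F (Set.Ici 0) 0 := by
    rw [← continuousWithinAt_Ioi_iff_Ici]
    have : F 0 = l₀ := by simp [hF]
    rw [ContinuousWithinAt, this]
    refine (hG0.comp hsqrt0).congr' ?_
    filter_upwards [self_mem_nhdsWithin] with v hv
    simp [hF, not_le.2 (Set.mem_Ioi.1 hv)]
  have hFtop : Tendsto F atTop
      (nhds (Real.sqrt Real.pi / 2 + Real.exp (4 * a * b) * -(Real.sqrt Real.pi / 2))) := by
    refine (hGtop.comp Real.tendsto_sqrt_atTop).congr' ?_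
    filter_upwards [eventually_gt_atTop 0] with v hv
    simp [hF, not_le.2 hv]
  have hderiv : ∀ v ∈ Set.Ioi (0 : ℝ), HasDerivAt F (a / (v * Real.sqrt v) *
      Real.exp (-(b * Real.sqrt v - a / Real.sqrt v) ^ 2)) v := by
    intro v hv
    have hv0 : (0 : ℝ) < v := hv
    have hs : 0 < Real.sqrt v := Real.sqrt_pos.2 hv0
    have hds := Real.hasDerivAt_sqrt hv0.ne'
    have hdG : HasDerivAt G (2 * a * (Real.sqrt v ^ 2)⁻¹ *
        Real.exp (-(b * Real.sqrt v - a / Real.sqrt v) ^ 2)) (Real.sqrt v) := by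
      have k1 : HasDerivAt (fun s : ℝ => b * s - a * s⁻¹)
          (b * 1 - a * -((Real.sqrt v) ^ 2)⁻¹) (Real.sqrt v) :=
        ((hasDerivAt_id _).const_mul b).sub ((hasDerivAt_inv hs.ne').const_mul a)
      have k2 : HasDerivAt (fun s : ℝ => -(b * s + a * s⁻¹))
          (-(b * 1 + a * -((Real.sqrt v) ^ 2)⁻¹)) (Real.sqrt v) :=
        (((hasDerivAt_id _).const_mul b).add ((hasDerivAt_inv hs.ne').const_mul a)).neg
      have := ((hasDerivAt_intervalIntegral_exp_neg_sq _).comp _ k1).add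
        (((hasDerivAt_intervalIntegral_exp_neg_sq _).comp _ k2).const_mul (Real.exp (4 * a * b)))
      refine this.congr_deriv ?_
      -- This is `(b * s + a / s) ^ 2 = (b * s - a / s) ^ 2 + 4 * a * b`.
      have e : Real.exp (4 * a * b) *
          Real.exp (-(-(b * Real.sqrt v + a * (Real.sqrt v)⁻¹)) ^ 2) =
          Real.exp (-(b * Real.sqrt v - a * (Real.sqrt v)⁻¹) ^ 2) := by
        rw [← Real.exp_add]; congr 1; field_simp; ring
      rw [← mul_assoc, e, div_eq_mul_inv]; ring
    have := hdG.comp v hds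
    have hF' : F =ᶠ[nhds v] G ∘ Real.sqrt := by
      filter_upwards [lt_mem_nhds hv0] with w hw
      simp [hF, not_le.2 hw]
    refine (this.congr_of_eventuallyEq hF').congr_deriv ?_
    rw [Real.sq_sqrt hv0.le]; field_simp
  have hnn : ∀ v ∈ Set.Ioi (0 : ℝ), 0 ≤ a / (v * Real.sqrt v) *
      Real.exp (-(b * Real.sqrt v - a / Real.sqrt v) ^ 2) := by
    intro v hv
    have hv0 : (0 : ℝ) < v := hv
    positivity
  refine ⟨integrableOn_Ioi_deriv_of_nonneg hFcont hderiv hnn hFtop, ?_⟩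
  rw [integral_Ioi_of_hasDerivAt_of_nonneg hFcont hderiv hnn hFtop]
  simp only [hF, le_refl, if_true, hl]; ring

theorem measurable_invGaussianPDFReal (m l : ℝ) : Measurable (invGaussianPDFReal m l) := by
  unfold invGaussianPDFReal
  exact Measurable.ite measurableSet_Ioi (by fun_prop) measurable_const

theorem invGaussianPDFReal_nonneg (m l v : ℝ) : 0 ≤ invGaussianPDFReal m l v := by
  unfold invGaussianPDFReal
  split_ifs <;> positivity

theorem lintegral_invGaussianPDFReal {m l : ℝ} (hm : 0 < m) (hl : 0 < l) :
    ∫⁻ v, ENNReal.ofReal (invGaussianPDFReal m l v) = 1 := by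
  set a := Real.sqrt (l / 2) with ha
  have ha0 : 0 < a := Real.sqrt_pos.2 (by positivity)
  have ha2 : a ^ 2 = l / 2 := Real.sq_sqrt (by positivity)
  obtain ⟨hi, he⟩ := integral_Ioi_invGaussian_kernel ha0 (div_pos ha0 hm)
  have hpdf : ∀ v ∈ Set.Ioi (0 : ℝ), invGaussianPDFReal m l v = (Real.sqrt Real.pi)⁻¹ *
      (a / (v * Real.sqrt v) * Real.exp (-(a / m * Real.sqrt v - a / Real.sqrt v) ^ 2)) := by
    intro v hv
    have hv0 : (0 : ℝ) < v := hv
    have hs2 : Real.sqrt v ^ 2 = v := Real.sq_sqrt hv0.le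
    have e1 : Real.sqrt (l / (2 * Real.pi * v ^ 3)) =
        (Real.sqrt Real.pi)⁻¹ * (a / (v * Real.sqrt v)) := by
      have : l / (2 * Real.pi * v ^ 3) = Real.pi⁻¹ * (l / 2 / (v ^ 2 * v)) := by
        field_simp
      rw [this, Real.sqrt_mul (by positivity), Real.sqrt_inv, Real.sqrt_div (by positivity),
        Real.sqrt_mul (by positivity), Real.sqrt_sq hv0.le]
    have e2 : -(l * (v - m) ^ 2) / (2 * m ^ 2 * v) =
        -(a / m * Real.sqrt v - a / Real.sqrt v) ^ 2 := by
      have : (a / m * Real.sqrt v - a / Real.sqrt v) ^ 2 =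
          a ^ 2 * (Real.sqrt v ^ 2 - m) ^ 2 / (m ^ 2 * Real.sqrt v ^ 2) := by
        have hs : 0 < Real.sqrt v := Real.sqrt_pos.2 hv0
        field_simp
      rw [this, hs2, ha2]; field_simp
    rw [invGaussianPDFReal, if_pos hv0, e1, e2, mul_assoc]
  have hind : ∀ v, ENNReal.ofReal (invGaussianPDFReal m l v) =
      (Set.Ioi (0 : ℝ)).indicator (fun v => ENNReal.ofReal ((Real.sqrt Real.pi)⁻¹ *
      (a / (v * Real.sqrt v) * Real.exp (-(a / m * Real.sqrt v - a / Real.sqrt v) ^ 2)))) v := by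
    intro v
    by_cases hv : v ∈ Set.Ioi (0 : ℝ)
    · rw [Set.indicator_of_mem hv, hpdf v hv]
    · rw [Set.indicator_of_notMem hv, invGaussianPDFReal, if_neg (show ¬0 < v from hv), ENNReal.ofReal_zero]
  simp_rw [hind]
  rw [lintegral_indicator measurableSet_Ioi, ← ofReal_integral_eq_lintegral_ofReal
    (hi.const_mul _), integral_const_mul, he, inv_mul_cancel₀ (by positivity), ENNReal.ofReal_one]
  filter_upwards [ae_restrict_mem measurableSet_Ioi] with v hv
  have hv0 : (0 : ℝ) < v := hv
  simp only [Pi.zero_apply]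
  positivity

theorem isProbabilityMeasure_invGaussianMeasure {m l : ℝ} (hm : 0 < m) (hl : 0 < l) :
    IsProbabilityMeasure (invGaussianMeasure m l) :=
  ⟨by rw [invGaussianMeasure, withDensity_apply _ MeasurableSet.univ, Measure.restrict_univ,
    lintegral_invGaussianPDFReal hm hl]⟩

/-! ### Tilting identities for the two mixing densities -/

theorem invGaussianPDFReal_mul_exp {m l q : ℝ} (hm : 0 < m) (hl : 0 < l) (hq : 0 < q) (v : ℝ) :
    invGaussianPDFReal m l v * Real.exp (l / (2 * m ^ 2) * (1 - q ^ 2) * v) =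
      Real.exp (l / m * (1 - q)) * invGaussianPDFReal (m / q) l v := by
  unfold invGaussianPDFReal
  split_ifs with hv
  · rw [mul_assoc, mul_left_comm (Real.exp _), ← Real.exp_add, ← Real.exp_add]
    congr 2
    field_simp; ring
  · simp

theorem invGaussianPDFReal_mul_exp_div {m l q : ℝ} (hm : 0 < m) (hl : 0 < l) (hq : 0 < q)
    (v : ℝ) :
    invGaussianPDFReal m l v * Real.exp (l * (1 - q ^ 2) / (2 * v)) =
      q⁻¹ * Real.exp (l / m * (1 - q)) * invGaussianPDFReal (m * q) (l * q ^ 2) v := by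
  unfold invGaussianPDFReal
  split_ifs with hv
  · have : l * q ^ 2 / (2 * Real.pi * v ^ 3) = q ^ 2 * (l / (2 * Real.pi * v ^ 3)) := by ring
    rw [this, Real.sqrt_mul (by positivity), Real.sqrt_sq hq.le]
    rw [show ∀ x y z : ℝ, q⁻¹ * x * (q * y * z) = (q⁻¹ * q) * (y * (x * z)) from
      fun x y z => by ring]
    rw [inv_mul_cancel₀ hq.ne', one_mul, mul_assoc, ← Real.exp_add, ← Real.exp_add]
    congr 2
    field_simp; ring
  · simp

theorem gammaPDFReal_mul_exp {k r c : ℝ} (hr : 0 < r) (hc : c < r) (v : ℝ) :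
    gammaPDFReal k r v * Real.exp (c * v) = (r / (r - c)) ^ k * gammaPDFReal k (r - c) v := by
  unfold gammaPDFReal
  split_ifs with hv
  · have hrc : 0 < r - c := by linarith
    have e : Real.exp (-((r - c) * v)) = Real.exp (-(r * v)) * Real.exp (c * v) := by
      rw [← Real.exp_add]; congr 1; ring
    have : 0 < (r - c) ^ k := by positivity
    rw [e, Real.div_rpow hr.le hrc.le]
    field_simp
  · simp

theorem gammaPDFReal_mul_inv {k r : ℝ} (hk : 1 < k) (hr : 0 < r) {v : ℝ} (hv0 : v ≠ 0) :
    gammaPDFReal k r v * v⁻¹ = r / (k - 1) * gammaPDFReal (k - 1) r v := by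
  unfold gammaPDFReal
  split_ifs with hv
  · have hv' : 0 < v := lt_of_le_of_ne hv hv0.symm
    have hk1 : 0 < k - 1 := by linarith
    have e1 : Real.Gamma k = (k - 1) * Real.Gamma (k - 1) := by
      have := Real.Gamma_add_one hk1.ne'
      rwa [sub_add_cancel] at this
    have e2 : r ^ k = r ^ (k - 1) * r := by
      rw [← Real.rpow_add_one hr.ne', sub_add_cancel]
    have e3 : v ^ (k - 1) = v ^ (k - 1 - 1) * v := by
      rw [← Real.rpow_add_one hv0, sub_add_cancel]
    have := Real.Gamma_pos_of_pos hk1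
    rw [e1, e2, e3]; field_simp
  · simp

/-! ### The standardized mixing laws are concentrated -/

/-- Law of the mixing variable, rescaled to have mean `1`. -/
noncomputable def standardMixingLaw (kind : NoiseKind) (h η : ℝ) : Measure ℝ :=
  (mixingLaw kind h η).map (h⁻¹ * ·)

theorem isProbabilityMeasure_mixingLaw (kind : NoiseKind) {h η : ℝ} (hh : 0 < h) (hη : 0 < η) :
    IsProbabilityMeasure (mixingLaw kind h η) := by
  cases kind
  · exact isProbabilityMeasure_invGaussianMeasure hh (by positivity)
  · exact isProbabilityMeasure_gammaMeasure (by positivity) (by positivity)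

theorem isProbabilityMeasure_standardMixingLaw (kind : NoiseKind) {h η : ℝ} (hh : 0 < h)
    (hη : 0 < η) : IsProbabilityMeasure (standardMixingLaw kind h η) := by
  have := isProbabilityMeasure_mixingLaw kind hh hη
  exact Measure.isProbabilityMeasure_map (by fun_prop)

theorem ae_mixingLaw_pos (kind : NoiseKind) {h η : ℝ} : ∀ᵐ v ∂(mixingLaw kind h η), 0 < v := by
  cases kind
  · refine (ae_withDensity_iff (measurable_invGaussianPDFReal _ _).ennreal_ofReal).2
      (Filter.Eventually.of_forall fun v hv => ?_)
    by_contra h0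
    simp [invGaussianPDFReal, h0] at hv
  · refine (ae_withDensity_iff (measurable_gammaPDFReal _ _).ennreal_ofReal).2 ?_
    filter_upwards [Measure.ae_ne volume (0 : ℝ)] with v hv0 hv
    by_contra h0
    have : ¬0 ≤ v := fun h1 => h0 (lt_of_le_of_ne h1 hv0.symm)
    simp [gammaPDFReal, this] at hv

theorem integral_standardMixingLaw (kind : NoiseKind) {h η : ℝ} {g : ℝ → ℝ} (hg : Measurable g)
    {C : ℝ} (hC : Integrable (fun v => g (h⁻¹ * v)) (mixingLaw kind h η) ∧
      ∫ v, g (h⁻¹ * v) ∂(mixingLaw kind h η) = C) :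
    Integrable g (standardMixingLaw kind h η) ∧ ∫ v, g v ∂(standardMixingLaw kind h η) = C := by
  have hm : AEMeasurable (fun v : ℝ => h⁻¹ * v) (mixingLaw kind h η) := by fun_prop
  exact ⟨(integrable_map_measure hg.aestronglyMeasurable hm).2 hC.1,
    (integral_map hm hg.aestronglyMeasurable).trans hC.2⟩

theorem ae_standardMixingLaw_pos (kind : NoiseKind) {h η : ℝ} (hh : 0 < h) :
    ∀ᵐ v ∂(standardMixingLaw kind h η), 0 < v := by
  refine (ae_map_iff (by fun_prop) measurableSet_Ioi).2 ?_
  filter_upwards [ae_mixingLaw_pos kind] with v hv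
  exact mul_pos (inv_pos.2 hh) hv

theorem isConcentratedMixing_gal {h η : ℝ} (hh : 0 < h) (hη : 0 < η) (ht : η / h ≤ 1 / 16) :
    IsConcentratedMixing (standardMixingLaw .gal h η) (η / h) 11000 := by
  have := isProbabilityMeasure_standardMixingLaw .gal hh hη
  set t := η / h with htdef
  have ht0 : 0 < t := by positivity
  have hk : 1 < h / η := by
    rw [one_lt_div hη]; rw [div_le_iff₀ hh] at ht; linarith
  have hinv : Integrable (fun v => v⁻¹) (standardMixingLaw .gal h η) ∧
      ∫ v, v⁻¹ ∂(standardMixingLaw .gal h η) = h * ((1 / η) / (h / η - 1)) := by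
    refine integral_standardMixingLaw .gal measurable_inv ?_
    have h0 := integral_withDensity_of_mul_eq (g := fun v => v⁻¹)
      (measurable_gammaPDFReal (h / η) (1 / η)) (measurable_gammaPDFReal (h / η - 1) (1 / η))
      (gammaPDFReal_nonneg (by linarith) (by positivity))
      (gammaPDFReal_nonneg (by positivity) (by positivity))
      (lintegral_gammaPDF_eq_one (by linarith) (by positivity))
      (by filter_upwards [Measure.ae_ne volume (0 : ℝ)] with v hv using
            gammaPDFReal_mul_inv hk (by positivity) hv)
    simp only [mul_inv, inv_inv]
    exact ⟨h0.1.const_mul h, by rw [integral_const_mul]; congr 1; exact h0.2⟩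
  -- The standardized law is Gamma with shape and rate both `1 / t`.
  refine isConcentratedMixing_of_mgf (ψ := fun a => -a + t⁻¹ * -Real.log (1 - a * t))
    (ψ' := fun a => -1 + (1 - a * t)⁻¹) ht0 ht (ae_standardMixingLaw_pos .gal hh) hinv.1 ?_ ?_ ?_
    ?_ ?_ ?_ ?_
  · rw [hinv.2]
    have e : h * (1 / η / (h / η - 1)) = (1 - t)⁻¹ := by
      have : h - η ≠ 0 := by rw [one_lt_div hη] at hk; linarith
      rw [htdef]; field_simp
    rw [e, inv_le_comm₀ (by linarith) (by norm_num)]; linarith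
  · intro a ha
    have hat := abs_le.1 ha
    have hpos : 0 < 1 - a * t := by linarith
    refine integral_standardMixingLaw .gal (by fun_prop) ?_
    have hc : a / h < 1 / η := by
      have : a / h = a * t * (1 / η) := by rw [htdef]; field_simp
      rw [this]; nlinarith [one_div_pos.2 hη]
    have h0 := integral_withDensity_of_mul_eq (g := fun v => Real.exp (a / h * v))
      (measurable_gammaPDFReal (h / η) (1 / η)) (measurable_gammaPDFReal (h / η) (1 / η - a / h))
      (gammaPDFReal_nonneg (by positivity) (by linarith))
      (gammaPDFReal_nonneg (by positivity) (by positivity))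
      (lintegral_gammaPDF_eq_one (by positivity) (by linarith))
      (Filter.Eventually.of_forall fun v => gammaPDFReal_mul_exp (by positivity) hc v)
    have e1 : ∀ v, Real.exp (a * (h⁻¹ * v - 1)) = Real.exp (-a) * Real.exp (a / h * v) := by
      intro v; rw [← Real.exp_add]; congr 1; field_simp; ring
    simp_rw [e1]
    refine ⟨h0.1.const_mul _, ?_⟩
    rw [integral_const_mul, Real.exp_add]
    congr 1
    refine h0.2.trans ?_
    have e2 : 1 / η / (1 / η - a / h) = (1 - a * t)⁻¹ := by
      have : 1 / η - a / h = (1 - a * t) / η := by rw [htdef]; field_simp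
      rw [this]; field_simp
    rw [e2, Real.rpow_def_of_pos (inv_pos.2 hpos), Real.log_inv, htdef, inv_div, mul_comm]
  · intro a ha
    have h1 := Real.abs_log_sub_add_sum_range_le (x := a * t) (by linarith) 1
    simp only [Finset.sum_range_succ, Finset.sum_range_zero, Nat.reduceAdd] at h1
    have h2 : |a * t| ^ 2 / (1 - |a * t|) ≤ 2 * (a * t) ^ 2 := by
      rw [div_le_iff₀ (by linarith), sq_abs]; nlinarith [sq_nonneg (a * t)]
    have h3 := (abs_le.1 (h1.trans h2)).1
    norm_num at h3
    have : t⁻¹ * -Real.log (1 - a * t) ≤ t⁻¹ * (a * t + 2 * (a * t) ^ 2) := by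
      gcongr; linarith
    have e : t⁻¹ * (a * t + 2 * (a * t) ^ 2) = a + 2 * t * a ^ 2 := by field_simp
    linarith
  · simp
  · intro a ha
    have hpos : 1 - a * t ≠ 0 := by linarith [(abs_lt.1 ha).2]
    have h1 : HasDerivAt (fun a => 1 - a * t) (-(1 * t)) a :=
      ((hasDerivAt_id a).mul_const t).const_sub 1
    refine ((hasDerivAt_id a).neg.add ((h1.log hpos).neg.const_mul t⁻¹)).congr_deriv ?_
    field_simp
  · simp
  · have h1 : HasDerivAt (fun a => 1 - a * t) (-(1 * t)) 0 :=
      ((hasDerivAt_id (0 : ℝ)).mul_const t).const_sub 1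
    refine ((h1.inv (by simp)).const_add (-1)).congr_deriv ?_
    simp

theorem isConcentratedMixing_nig {h η : ℝ} (hh : 0 < h) (hη : 0 < η) (ht : η / h ≤ 1 / 16) :
    IsConcentratedMixing (standardMixingLaw .nig h η) (η / h) 11000 := by
  have := isProbabilityMeasure_standardMixingLaw .nig hh hη
  set t := η / h with htdef
  have ht0 : 0 < t := by positivity
  have hl : 0 < h ^ 2 / η := by positivity
  have hlh : h ^ 2 / η / h = t⁻¹ := by rw [htdef]; field_simp
  have hpos := ae_standardMixingLaw_pos .nig (η := η) hh
  -- The inverse moment is bounded through `v⁻¹ ≤ exp v⁻¹`, because the exponential of `v⁻¹` merely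
  -- tilts one inverse Gaussian density into another and so has an exact expectation.
  have hexpinv : Integrable (fun v => Real.exp v⁻¹) (standardMixingLaw .nig h η) ∧
      ∫ v, Real.exp v⁻¹ ∂(standardMixingLaw .nig h η) =
        (Real.sqrt (1 - 2 * t))⁻¹ * Real.exp (t⁻¹ * (1 - Real.sqrt (1 - 2 * t))) := by
    refine integral_standardMixingLaw .nig (by fun_prop) ?_
    have hq : 0 < Real.sqrt (1 - 2 * t) := Real.sqrt_pos.2 (by linarith)
    have h0 := integral_withDensity_of_mul_eq
      (measurable_invGaussianPDFReal h (h ^ 2 / η)) (measurable_invGaussianPDFReal _ _)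
      (invGaussianPDFReal_nonneg _ _) (invGaussianPDFReal_nonneg _ _)
      (lintegral_invGaussianPDFReal (mul_pos hh hq) (mul_pos hl (pow_pos hq 2)))
      (Filter.Eventually.of_forall fun v => invGaussianPDFReal_mul_exp_div hh hl hq v)
    rw [Real.sq_sqrt (by linarith), hlh] at h0
    have e : ∀ v : ℝ, (h⁻¹ * v)⁻¹ = h ^ 2 / η * (1 - (1 - 2 * t)) / (2 * v) := by
      intro v; rw [htdef]; field_simp; ring
    simp_rw [e]
    exact h0
  have hle : ∀ᵐ v ∂(standardMixingLaw .nig h η), v⁻¹ ≤ Real.exp v⁻¹ :=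
    Filter.Eventually.of_forall fun v => by linarith [Real.add_one_le_exp v⁻¹]
  have hinv : Integrable (fun v => v⁻¹) (standardMixingLaw .nig h η) := by
    refine hexpinv.1.mono' (by fun_prop) ?_
    filter_upwards [hpos, hle] with v hv hv'
    rwa [Real.norm_of_nonneg (inv_pos.2 hv).le]
  refine isConcentratedMixing_of_mgf
    (ψ := fun a => -a + t⁻¹ * (1 - Real.sqrt (1 - 2 * (a * t))))
    (ψ' := fun a => -1 + (Real.sqrt (1 - 2 * (a * t)))⁻¹) ht0 ht hpos hinv ?_ ?_ ?_ ?_ ?_ ?_ ?_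
  · refine (integral_mono_ae hinv hexpinv.1 hle).trans ?_
    rw [hexpinv.2]
    have h1 : (Real.sqrt (1 - 2 * t))⁻¹ ≤ 2 := by
      rw [inv_le_comm₀ (Real.sqrt_pos.2 (by linarith)) (by norm_num)]
      exact Real.le_sqrt_of_sq_le (by linarith)
    have h2 : t⁻¹ * (1 - Real.sqrt (1 - 2 * t)) ≤ 2 := by
      have : 1 - 2 * t ≤ Real.sqrt (1 - 2 * t) := Real.le_sqrt_of_sq_le (by nlinarith)
      rw [inv_mul_le_iff₀ ht0]; linarith
    have h3 : Real.exp 2 ≤ 9 := by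
      have : Real.exp 2 = Real.exp 1 * Real.exp 1 := by rw [← Real.exp_add]; norm_num
      rw [this]; nlinarith [Real.exp_one_lt_d9, Real.exp_pos 1]
    calc _ ≤ 2 * Real.exp 2 := by gcongr
      _ ≤ _ := by linarith
  · intro a ha
    have hat := abs_le.1 ha
    have hq : 0 < Real.sqrt (1 - 2 * (a * t)) := Real.sqrt_pos.2 (by linarith)
    refine integral_standardMixingLaw .nig (by fun_prop) ?_
    have h0 := integral_withDensity_of_mul_eq
      (measurable_invGaussianPDFReal h (h ^ 2 / η)) (measurable_invGaussianPDFReal _ _)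
      (invGaussianPDFReal_nonneg _ _) (invGaussianPDFReal_nonneg _ _)
      (lintegral_invGaussianPDFReal (div_pos hh hq) hl)
      (Filter.Eventually.of_forall fun v => invGaussianPDFReal_mul_exp hh hl hq v)
    rw [Real.sq_sqrt (by linarith), hlh] at h0
    have e1 : ∀ v, Real.exp (a * (h⁻¹ * v - 1)) = Real.exp (-a) *
        Real.exp (h ^ 2 / η / (2 * h ^ 2) * (1 - (1 - 2 * (a * t))) * v) := by
      intro v; rw [← Real.exp_add]; congr 1; rw [htdef]; field_simp; ring
    simp_rw [e1]
    refine ⟨h0.1.const_mul _, ?_⟩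
    rw [integral_const_mul, Real.exp_add]
    congr 1
    exact h0.2
  · intro a ha
    set x := a * t with hx
    have hx4 := abs_le.1 ha
    have h1 : 1 - x - x ^ 2 ≤ Real.sqrt (1 - 2 * x) := by
      refine Real.le_sqrt_of_sq_le ?_
      nlinarith [sq_nonneg x, mul_nonneg (sq_nonneg x) (by nlinarith : 0 ≤ 1 - 2 * x - x ^ 2)]
    have : t⁻¹ * (1 - Real.sqrt (1 - 2 * x)) ≤ t⁻¹ * (x + 2 * x ^ 2) := by
      gcongr; nlinarith [sq_nonneg x]
    have e : t⁻¹ * (x + 2 * x ^ 2) = a + 2 * t * a ^ 2 := by rw [hx]; field_simp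
    linarith
  · simp
  · intro a ha
    have hp : 0 < 1 - 2 * (a * t) := by linarith [(abs_lt.1 ha).2]
    have h1 : HasDerivAt (fun a => 1 - 2 * (a * t)) (-(2 * (1 * t))) a :=
      (((hasDerivAt_id a).mul_const t).const_mul 2).const_sub 1
    refine ((hasDerivAt_id a).neg.add (((h1.sqrt hp.ne').const_sub 1).const_mul
      t⁻¹)).congr_deriv ?_
    have := Real.sqrt_pos.2 hp
    field_simp
  · simp
  · have h1 : HasDerivAt (fun a => 1 - 2 * (a * t)) (-(2 * (1 * t))) 0 :=
      (((hasDerivAt_id (0 : ℝ)).mul_const t).const_mul 2).const_sub 1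
    refine (((h1.sqrt (by simp)).inv (by simp)).const_add (-1)).congr_deriv ?_
    simp; ring

theorem isConcentratedMixing_standardMixingLaw (kind : NoiseKind) {h η : ℝ} (hh : 0 < h)
    (hη : 0 < η) (ht : η / h ≤ 1 / 16) :
    IsConcentratedMixing (standardMixingLaw kind h η) (η / h) 11000 := by
  cases kind
  · exact isConcentratedMixing_nig hh hη ht
  · exact isConcentratedMixing_gal hh hη ht

/-! ### Reduction of the model to standardized components -/

theorem noiseLaw_zero_eq_map (kind : NoiseKind) {h σ η : ℝ} (hh : 0 < h) :
    noiseLaw kind h σ η 0 = ((standardMixingLaw kind h η).bind fun v =>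
      gaussianReal 0 v.toNNReal).map (σ * Real.sqrt h * ·) := by
  have hm1 : Measurable fun v : ℝ => gaussianReal 0 (σ ^ 2 * v).toNNReal :=
    measurable_gaussianReal_toNNReal.comp (measurable_const_mul (σ ^ 2))
  have hc : Measurable fun x : ℝ => σ * Real.sqrt h * x := by fun_prop
  have e0 : noiseLaw kind h σ η 0 =
      (mixingLaw kind h η).bind fun v => gaussianReal 0 (σ ^ 2 * v).toNNReal := by
    simp [noiseLaw]
  rw [e0]
  ext s hs
  have hms : Measurable fun v : ℝ =>
      gaussianReal 0 v.toNNReal ((fun x => σ * Real.sqrt h * x) ⁻¹' s) :=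
    (Measure.measurable_coe (hc hs)).comp measurable_gaussianReal_toNNReal
  rw [Measure.map_apply hc hs, Measure.bind_apply hs hm1.aemeasurable,
    Measure.bind_apply (hc hs) measurable_gaussianReal_toNNReal.aemeasurable, standardMixingLaw,
    lintegral_map hms (by fun_prop)]
  refine lintegral_congr fun v => ?_
  rw [← Measure.map_apply hc hs, gaussianReal_map_const_mul, mul_zero]
  congr 2
  rw [Real.toNNReal_mul (sq_nonneg σ), Real.toNNReal_mul (inv_nonneg.2 hh.le), ← mul_assoc]
  congr 1
  ext
  simp only [NNReal.coe_mul, NNReal.coe_mk, Real.coe_toNNReal _ (sq_nonneg σ),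
    Real.coe_toNNReal _ (inv_nonneg.2 hh.le), mul_pow, Real.sq_sqrt hh.le]
  field_simp

theorem gaussianReal_eq_map {h σ : ℝ} (hh : 0 < h) :
    gaussianReal 0 (σ ^ 2 * h).toNNReal =
      (gaussianReal 0 1).map (σ * Real.sqrt h * ·) := by
  rw [gaussianReal_map_const_mul, mul_zero, mul_one]
  congr 1
  ext
  simp only [NNReal.coe_mk, mul_pow, Real.sq_sqrt hh.le]
  exact Real.coe_toNNReal _ (by positivity)

/-- Both tail-correction factors equal 1 in the symmetric case, which is why the two
parameterizations share their constants. -/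
theorem Parameterization.eta_zero (par : Parameterization) (kind : NoiseKind) (e : ℝ) :
    par.eta kind e 0 = e := by
  cases par <;> cases kind <;> simp [Parameterization.eta]
  ring

theorem Parameterization.mu_zero (par : Parameterization) (kind : NoiseKind) (e : ℝ) :
    par.mu kind e 0 = 0 := by
  cases par <;> simp [Parameterization.mu]

theorem symmetricKLD_eq_sum (par : Parameterization) (kind : NoiseKind) {n : ℕ}
    {D : Matrix (Fin n) (Fin n) ℝ} (hD : IsUnit D.det) {h : Fin n → ℝ} (hh : ∀ i, 0 < h i)
    {σ e : ℝ} (hσ : 0 < σ) (he : 0 < e) :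
    symmetricKLD par kind D h σ e = ∑ i, InformationTheory.klDiv
      ((standardMixingLaw kind (h i) e).bind fun v => gaussianReal 0 v.toNNReal)
      (gaussianReal 0 1) := by
  have hν := fun i => isProbabilityMeasure_standardMixingLaw kind (hh i) he
  have hP : ∀ i, IsProbabilityMeasure (noiseLaw kind (h i) σ e 0) := fun i => by
    rw [noiseLaw_zero_eq_map kind (hh i)]
    exact Measure.isProbabilityMeasure_map (by fun_prop)
  rw [symmetricKLD, par.eta_zero, par.mu_zero, flexibleLaw, baseLaw,
    klDiv_map_mulVec (D.isUnit_nonsing_inv_det hD), klDiv_pi]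
  refine Finset.sum_congr rfl fun i _ => ?_
  rw [noiseLaw_zero_eq_map kind (hh i), gaussianReal_eq_map (hh i),
    klDiv_map_const_mul (mul_pos hσ (Real.sqrt_pos.2 (hh i))).ne']

theorem symmetricKLD_expansion (par : Parameterization) (kind : NoiseKind) {n : ℕ}
    {D : Matrix (Fin n) (Fin n) ℝ} (hD : IsUnit D.det) {h : Fin n → ℝ} (hh : ∀ i, 0 < h i)
    {σ : ℝ} (hσ : 0 < σ) :
    ∃ B : ℝ, ∀ᶠ e in nhdsWithin 0 (Set.Ioi 0), symmetricKLD par kind D h σ e ≠ ⊤ ∧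
      |(symmetricKLD par kind D h σ e).toReal - 3 / 16 * (∑ i, 1 / h i ^ 2) * e ^ 2| ≤
        B * e ^ 3 := by
  obtain ⟨C, t₀, ht₀, hC⟩ := exists_klDiv_bind_gaussianReal_bound 11000 (by norm_num)
  refine ⟨∑ i, C / h i ^ 3, ?_⟩
  have hsmall : ∀ i, ∀ᶠ e in nhdsWithin (0 : ℝ) (Set.Ioi 0), e / h i ≤ min t₀ (1 / 16) := by
    intro i
    have hlim : Filter.Tendsto (fun e => e / h i) (nhds 0) (nhds (0 / h i)) :=
      (continuous_id.div_const (h i)).tendsto 0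
    rw [zero_div] at hlim
    exact ((hlim.mono_left nhdsWithin_le_nhds).eventually_lt_const
      (lt_min ht₀ (by norm_num))).mono fun e he => he.le
  filter_upwards [Filter.eventually_all.2 hsmall, self_mem_nhdsWithin] with e hes he
  have he0 : (0 : ℝ) < e := he
  have hk : ∀ i, _ := fun i =>
    have := isProbabilityMeasure_standardMixingLaw kind (hh i) he0
    hC (standardMixingLaw kind (h i) e) (e / h i) (div_pos he0 (hh i))
      ((hes i).trans (min_le_left _ _)) (isConcentratedMixing_standardMixingLaw kind (hh i) he0
        ((hes i).trans (min_le_right _ _)))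
  rw [symmetricKLD_eq_sum par kind hD hh hσ he0]
  refine ⟨ENNReal.sum_ne_top.2 fun i _ => (hk i).1, ?_⟩
  rw [ENNReal.toReal_sum fun i _ => (hk i).1, Finset.mul_sum, Finset.sum_mul, Finset.sum_mul,
    ← Finset.sum_sub_distrib]
  refine (Finset.abs_sum_le_sum_abs _ _).trans (Finset.sum_le_sum fun i _ => ?_)
  have e1 : 3 / 16 * (1 / h i ^ 2) * e ^ 2 = 3 / 16 * (e / h i) ^ 2 := by ring
  have e2 : C / h i ^ 3 * e ^ 3 = C * (e / h i) ^ 3 := by ring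
  rw [e1, e2]
  exact (hk i).2

/-! ### Uniqueness of the expansion and the asymptotic distance -/

theorem isLittleO_pow_succ_nhdsGT (n : ℕ) :
    (fun e : ℝ => e ^ (n + 1)) =o[nhdsWithin 0 (Set.Ioi 0)] fun e => e ^ n :=
  (Asymptotics.isLittleO_pow_pow n.lt_succ_self).mono nhdsWithin_le_nhds

/-- Induction on `n`: the limit at 0 kills the constant coefficient, and dividing by `X` lowers both
the degree and the order by one. -/
theorem Polynomial.eq_zero_of_isLittleO_pow : ∀ (n : ℕ) (p : Polynomial ℝ), p.natDegree ≤ n →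
    (fun e => p.eval e) =o[nhdsWithin 0 (Set.Ioi 0)] (fun e : ℝ => e ^ n) → p = 0
  | n, p, hp, ho => by
    have h0 : p.coeff 0 = 0 := by
      have h1 : Filter.Tendsto (fun e => p.eval e) (nhdsWithin 0 (Set.Ioi 0)) (nhds 0) := by
        have hO : (fun e : ℝ => e ^ n) =O[nhdsWithin 0 (Set.Ioi 0)] fun _ => (1 : ℝ) :=
          ((((continuous_pow n).tendsto (0 : ℝ)).mono_left nhdsWithin_le_nhds)).isBigO_one ℝ
        exact (Asymptotics.isLittleO_one_iff ℝ).1 (ho.trans_isBigO hO)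
      have h2 : Filter.Tendsto (fun e => p.eval e) (nhdsWithin 0 (Set.Ioi 0))
          (nhds (p.eval 0)) := (p.continuous.tendsto 0).mono_left nhdsWithin_le_nhds
      rw [p.coeff_zero_eq_eval_zero]
      exact tendsto_nhds_unique h2 h1
    have hpX : p = p.divX * Polynomial.X := by
      conv_lhs => rw [← p.divX_mul_X_add, h0, Polynomial.C_0, add_zero]
    match n, hp, ho with
    | 0, hp, _ => rw [Polynomial.eq_C_of_natDegree_le_zero hp, h0, Polynomial.C_0]
    | n + 1, hp, ho =>
      have hd : p.divX = 0 := by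
        refine Polynomial.eq_zero_of_isLittleO_pow n p.divX
          (by rw [Polynomial.natDegree_divX_eq_natDegree_tsub_one]; omega) ?_
        have := ho.mul_isBigO (Asymptotics.isBigO_refl (fun e : ℝ => e⁻¹) _)
        refine this.congr' ?_ ?_
        · filter_upwards [self_mem_nhdsWithin] with e he
          have he0 : e ≠ 0 := (Set.mem_Ioi.1 he).ne'
          conv_lhs => rw [hpX]
          rw [Polynomial.eval_mul, Polynomial.eval_X, mul_inv_cancel_right₀ he0]
        · filter_upwards [self_mem_nhdsWithin] with e he
          have he0 : e ≠ 0 := (Set.mem_Ioi.1 he).ne'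
          rw [pow_succ, mul_inv_cancel_right₀ he0]
      rw [hpX, hd, zero_mul]

theorem IsSecondOrderExpansion.unique {f : ℝ → ℝ} {q q' : Polynomial ℝ}
    (h : IsSecondOrderExpansion f q) (h' : IsSecondOrderExpansion f q') : q' = q := by
  refine sub_eq_zero.1 (Polynomial.eq_zero_of_isLittleO_pow 2 _
    ((Polynomial.natDegree_sub_le _ _).trans (max_le h'.1 h.1)) ?_)
  refine (h.2.sub h'.2).congr_left fun e => ?_
  rw [Polynomial.eval_sub]; ring

theorem isEquivalent_pcDistance {K : ℝ → ℝ} {c : ℝ} (hc : 0 < c)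
    (hK : (fun e => K e - c * e ^ 2) =O[nhdsWithin 0 (Set.Ioi 0)] fun e => e ^ 3) :
    Asymptotics.IsEquivalent (nhdsWithin 0 (Set.Ioi 0)) (pcDistance K)
      fun e => Real.sqrt (2 * c) * e := by
  have h1 : Filter.Tendsto (fun e => (K e - c * e ^ 2) / e ^ 2) (nhdsWithin 0 (Set.Ioi 0))
      (nhds 0) := (hK.trans_isLittleO (isLittleO_pow_succ_nhdsGT 2)).tendsto_div_nhds_zero
  have h2 : Filter.Tendsto (fun e => Real.sqrt ((K e - c * e ^ 2) / e ^ 2 / c + 1))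
      (nhdsWithin 0 (Set.Ioi 0)) (nhds 1) := by
    have := ((h1.div_const c).add_const 1).sqrt
    simpa using this
  refine Asymptotics.isEquivalent_of_tendsto_one (h2.congr' ?_)
  filter_upwards [self_mem_nhdsWithin] with e he
  have he0 : (0 : ℝ) < e := he
  have e1 : (K e - c * e ^ 2) / e ^ 2 / c + 1 = 2 * K e / (2 * c * e ^ 2) := by
    field_simp; ring
  rw [e1, Real.sqrt_div' _ (by positivity), Real.sqrt_mul (by positivity : 0 ≤ 2 * c), Real.sqrt_sq he0.le]
  rfl

/-! ### The penalized complexity prior for a linear distance -/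

theorem expMeasure_map_const_mul {r s : ℝ} (hr : 0 < r) (hs : 0 < s) :
    (expMeasure (r * s)).map (s * ·) = expMeasure r := by
  have := isProbabilityMeasure_expMeasure (mul_pos hr hs)
  have := isProbabilityMeasure_expMeasure hr
  have hm : Measurable fun x : ℝ => s * x := by fun_prop
  have : IsProbabilityMeasure ((expMeasure (r * s)).map (s * ·)) :=
    Measure.isProbabilityMeasure_map hm.aemeasurable
  refine Measure.eq_of_cdf _ _ ?_
  ext x
  have e : cdf ((expMeasure (r * s)).map (s * ·)) x = cdf (expMeasure (r * s)) (x / s) := by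
    rw [cdf_eq_real, cdf_eq_real, map_measureReal_apply hm measurableSet_Iic]
    congr 1
    ext y
    simp [le_div_iff₀ hs, mul_comm]
  rw [e, cdf_expMeasure_eq (mul_pos hr hs), cdf_expMeasure_eq hr]
  have h0 : 0 ≤ x / s ↔ 0 ≤ x := by rw [le_div_iff₀ hs, zero_mul]
  simp only [h0]
  have : r * s * (x / s) = r * x := by field_simp
  rw [this]

theorem expMeasure_Iio_zero (r : ℝ) : expMeasure r (Set.Iio 0) = 0 :=
  (withDensity_apply _ measurableSet_Iio).trans (lintegral_exponentialPDF_of_nonpos le_rfl)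

/-- A measure without mass on the negative half-line sees `d` only as multiplication by `s`, which
is invertible, so the image determines the measure. The support condition matters: the distance
built from `c * e ^ 2` is even in `e`. -/
theorem isPCPrior_iff {d : ℝ → ℝ} {s θ : ℝ} (hs : 0 < s) (hθ : 0 < θ)
    (hd : ∀ e, 0 ≤ e → d e = s * e) (P : Measure ℝ) :
    IsPCPrior d θ P ↔ P = expMeasure (θ * s) := by
  have hmap : ∀ Q : Measure ℝ, Q (Set.Iio 0) = 0 → Q.map d = Q.map (s * ·) := by
    intro Q hQ
    refine Measure.map_congr ?_
    have : ∀ᵐ e ∂Q, e ∉ Set.Iio (0 : ℝ) := measure_eq_zero_iff_ae_notMem.1 hQ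
    filter_upwards [this] with e he using hd e (not_lt.1 he)
  have hinv : ∀ Q : Measure ℝ, (Q.map (s * ·)).map (s⁻¹ * ·) = Q := by
    intro Q
    rw [Measure.map_map (by fun_prop) (by fun_prop)]
    have : ((fun x : ℝ => s⁻¹ * x) ∘ fun x => s * x) = id := by
      ext x; simp [hs.ne']
    rw [this, Measure.map_id]
  constructor
  · rintro ⟨h0, h1⟩
    rw [hmap P h0, ← expMeasure_map_const_mul hθ hs] at h1
    rw [← hinv P, h1, hinv]
  · rintro rfl
    refine ⟨expMeasure_Iio_zero _, ?_⟩
    rw [hmap _ (expMeasure_Iio_zero _), expMeasure_map_const_mul hθ hs]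

theorem pcPriorDensity_eq {d : ℝ → ℝ} {s : ℝ} (θ : ℝ) (hs : 0 < s)
    (hd : ∀ e, 0 ≤ e → d e = s * e) (e : ℝ) :
    pcPriorDensity d θ e = exponentialPDFReal (θ * s) e := by
  rw [pcPriorDensity, exponentialPDFReal, gammaPDFReal]
  by_cases he : 0 ≤ e
  · have : HasDerivWithinAt d s (Set.Ici 0) e :=
      (((hasDerivAt_id e).const_mul s).hasDerivWithinAt.congr (fun x hx => hd x hx)
        (hd e he)).congr_deriv (mul_one s)
    rw [if_pos he, if_pos he, this.derivWithin (uniqueDiffOn_Ici 0 e he), hd e he,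
      abs_of_pos hs]
    simp [mul_assoc]
  · rw [if_neg he, if_neg he]

theorem mainTheorem2 (kind : NoiseKind) (par : Parameterization) {n : ℕ} (hn : 0 < n)
    (D : Matrix (Fin n) (Fin n) ℝ) (hD : IsUnit D.det)
    (h : Fin n → ℝ) (hh : ∀ i, 0 < h i) (σ : ℝ) (hσ : 0 < σ) :
    ∃ c : ℝ, c = 3 / 16 * ∑ i, 1 / h i ^ 2 ∧ 0 < c ∧
      -- second-order behaviour of the divergence of the models
      (∀ᶠ e in nhdsWithin 0 (Set.Ioi 0), symmetricKLD par kind D h σ e ≠ ⊤) ∧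
      (fun e => (symmetricKLD par kind D h σ e).toReal - c * e ^ 2)
        =O[nhdsWithin 0 (Set.Ioi 0)] (fun e => e ^ 3) ∧
      Asymptotics.IsEquivalent (nhdsWithin 0 (Set.Ioi 0))
        (pcDistance fun e => (symmetricKLD par kind D h σ e).toReal)
        (fun e => Real.sqrt (2 * c) * e) ∧
      -- the expansion is unique, and the distance and the prior built from it are as claimed
      ∃ q : Polynomial ℝ, q = Polynomial.C c * Polynomial.X ^ 2 ∧
        IsSecondOrderExpansion (fun e => (symmetricKLD par kind D h σ e).toReal) q ∧
        (∀ q' : Polynomial ℝ,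
          IsSecondOrderExpansion (fun e => (symmetricKLD par kind D h σ e).toReal) q' →
            q' = q) ∧
        (∀ e, 0 ≤ e → pcDistance (fun t => q.eval t) e = Real.sqrt (2 * c) * e) ∧
        DifferentiableOn ℝ (pcDistance fun t => q.eval t) (Set.Ici 0) ∧
        ∀ θ : ℝ, 0 < θ → ∃ θη : ℝ, θη = θ * Real.sqrt (2 * c) ∧ 0 < θη ∧
          (∀ P : Measure ℝ,
            IsPCPrior (pcDistance fun t => q.eval t) θ P ↔ P = expMeasure θη) ∧
          (∀ e, pcPriorDensity (pcDistance fun t => q.eval t) θ e = exponentialPDFReal θη e) ∧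
          ∃ C : ℝ, ∀ e, 0 ≤ e →
            Real.log (pcPriorDensity (pcDistance fun t => q.eval t) θ e) = -(θη * e) + C := by
  obtain ⟨B, hB⟩ := symmetricKLD_expansion par kind hD hh hσ
  set c : ℝ := 3 / 16 * ∑ i, 1 / h i ^ 2 with hcdef
  have hc : 0 < c := by
    have : Nonempty (Fin n) := ⟨⟨0, hn⟩⟩
    refine mul_pos (by norm_num) (Finset.sum_pos (fun i _ => ?_) Finset.univ_nonempty)
    have := hh i
    positivity
  have hO : (fun e => (symmetricKLD par kind D h σ e).toReal - c * e ^ 2)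
      =O[nhdsWithin 0 (Set.Ioi 0)] (fun e => e ^ 3) := by
    refine Asymptotics.IsBigO.of_bound B ?_
    filter_upwards [hB, self_mem_nhdsWithin] with e he he0
    have : (0 : ℝ) < e := he0
    rw [Real.norm_eq_abs, Real.norm_of_nonneg (by positivity)]
    exact he.2
  have hs : 0 < Real.sqrt (2 * c) := Real.sqrt_pos.2 (by linarith)
  have hexp : IsSecondOrderExpansion (fun e => (symmetricKLD par kind D h σ e).toReal)
      (Polynomial.C c * Polynomial.X ^ 2) := by
    refine ⟨Polynomial.natDegree_C_mul_X_pow_le c 2, ?_⟩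
    simp only [Polynomial.eval_mul, Polynomial.eval_C, Polynomial.eval_pow, Polynomial.eval_X]
    exact hO.trans_isLittleO (isLittleO_pow_succ_nhdsGT 2)
  have hd : ∀ e, 0 ≤ e → pcDistance
      (fun t => (Polynomial.C c * Polynomial.X ^ 2).eval t) e = Real.sqrt (2 * c) * e := by
    intro e he
    simp only [pcDistance, Polynomial.eval_mul, Polynomial.eval_C, Polynomial.eval_pow,
      Polynomial.eval_X]
    rw [← mul_assoc, Real.sqrt_mul (by positivity), Real.sqrt_sq he]
  refine ⟨c, rfl, hc, hB.mono fun e he => he.1, hO, isEquivalent_pcDistance hc hO, _, rfl, hexp,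
    fun q' hq' => hexp.unique hq', hd, ?_, ?_⟩
  · exact (differentiableOn_id.const_mul (Real.sqrt (2 * c))).congr fun e he => hd e he
  · intro θ hθ
    refine ⟨_, rfl, mul_pos hθ hs, isPCPrior_iff hs hθ hd, pcPriorDensity_eq θ hs hd,
      Real.log (θ * Real.sqrt (2 * c)), fun e he => ?_⟩
    rw [pcPriorDensity_eq θ hs hd, exponentialPDFReal, gammaPDFReal, if_pos he]
    simp only [Real.rpow_one, Real.Gamma_one, div_one, sub_self, Real.rpow_zero, mul_one]
    rw [Real.log_mul (mul_pos hθ hs).ne' (Real.exp_pos _).ne', Real.log_exp, add_comm]
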